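/- Let $k$ be a field of characteristic $0$, $V$ a $k$-vector space of finite dimension $n$, and $\mathcal W\subset GL(V)$ a finite reflection group, i.e. a finite group generated by elements $g$ such that $g-1$ has rank one. It acts on the symmetric algebra $SV$. For a symmetric bilinear form $B_V$ on $V$ (possibly degenerate) let $\mathrm{Cl}(V,B_V)$ be the Clifford algebra with relations $xy+yx=2B_V(x,y)$, and let $\mathcal K(V,B_V)=SV\otimes \mathrm{Cl}(V,B_V)$, with its $\mathbf Z_2$-grading in which $SV$ is even and $1\otimes V$ is odd, and with the odd derivation $d$ given by $d(1\otimes x)=x\otimes 1$, $d(x\otimes 1)=0$ for $x\in V$. A cochain of transgression for $p\in SV$ is an odd element $C_p\in \mathcal K(V,B_V)$ with $dC_p=p\otimes 1$. The algebra $(SV)^{\mathcal W}$ is generated by $n$ algebraically independent homogeneous elements. For every symmetric $B_V$, the cohomology $H(\mathcal K(V,B_V),d)$ is trivial, i.e. equal to $k$, and $\mathcal K(V,B_V)$ is a free $(SV)^{\mathcal W}$-module. Moreover, let $p_1,\dots,p_n$ be any algebraically independent homogeneous generators of $(SV)^{\mathcal W}$, let $P=\langle p_1,\dots,p_n\rangle_k$,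 and let $\langle S^+P\rangle$ be the ideal of $\mathcal K(V,B_V)$ generated by $p_1\otimes 1,\dots,p_n\otimes 1$. Then: 1. For every basis $\{e_a\}$ of $V$ and every $i$, the element $\frac{1}{\deg p_i}\sum_a\frac{\partial p_i}{\partial e_a}\otimes e_a$ is a cochain of transgression for $p_i$. 2. There is a symmetric bilinear form $B$ on $P$ such that $B(p,q)=\frac12[C_pC_q+C_qC_p]\in H(\mathcal K(V,B_V),d)= k$ for all $p,q\in P$ and all cochains of transgression $C_p$, $C_q$. For every basis $\{e_a\}$ of $V$, $$B(p_i,p_j)=\Big[\sum_{a,b}\frac{\partial p_i}{\partial e_a}\frac{\partial p_j}{\partial e_b}B_V(e_a,e_b)\Big]\in H(\mathcal K(V,B_V),d)=k,$$ and $B=0$ if all $\deg p_i\ge 2$. 3. There is an isomorphism of algebras $\mathrm{Cl}(P,B)\cong H(\mathcal K(V,B_V)/\langle S^+P\rangle,d)$ which sends every $p\in P$ to the class $[C_p]$ of any cochain of transgression $C_p$ for $p$. The same holds for the classical Koszul algebra $K(V)=SV\otimes\bigwedge V$: $H(K(V),d)=k$, $K(V)$ is a free $(SV)^{\mathcal W}$-module,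 the elements in 1 are cochains of transgression for the $p_i$, the form $\frac12[C_pC_q+C_qC_p]$ vanishes identically on $P$, and there is an isomorphism of algebras $\bigwedge P\cong H(K(V)/\langle S^+P\rangle,d)$ which sends every $p\in P$ to $[C_p]$. -/

import Mathlib

open scoped TensorProduct

noncomputable section

/-! ### `ℤ/2`-graded differential algebras and their cohomology -/

/-- A `ℤ/2`-graded differential `k`-algebra structure on `A` (for `2` invertible in `k`).
The grading is recorded by its parity automorphism `a ↦ (-1)^{|a|} a`: the even (odd) part of `A`
is the eigenspace of `parity` for the eigenvalue `1` (`-1`). The differential is odd, is a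
graded derivation, and squares to zero. -/
structure DiffSuperAlgebra (k A : Type*) [CommRing k] [Ring A] [Algebra k A] where
  /-- the automorphism `a ↦ (-1)^{|a|} a` -/
  parity : A →ₐ[k] A
  /-- the differential -/
  d : A →ₗ[k] A
  parity_parity : ∀ a, parity (parity a) = a
  d_parity : ∀ a, d (parity a) = -parity (d a)
  d_mul : ∀ a b, d (a * b) = d a * b + parity a * d b
  d_d : ∀ a, d (d a) = 0

namespace DiffSuperAlgebra

variable {k A : Type*} [CommRing k] [Ring A] [Algebra k A] (D : DiffSuperAlgebra k A)

theorem d_one : D.d 1 = 0 := by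
  have h := D.d_mul 1 1
  simpa using h

/-- The subalgebra `ker d` of cocycles. -/
def cocycles : Subalgebra k A where
  carrier := {a | D.d a = 0}
  mul_mem' := by
    intro a b ha hb
    simp only [Set.mem_ofPred_eq] at ha hb ⊢
    rw [D.d_mul, ha, hb, zero_mul, mul_zero, add_zero]
  add_mem' := by
    intro a b ha hb
    simp only [Set.mem_ofPred_eq] at ha hb ⊢
    rw [map_add, ha, hb, add_zero]
  algebraMap_mem' := by
    intro r
    simp only [Set.mem_ofPred_eq]
    rw [Algebra.algebraMap_eq_smul_one, map_smul, D.d_one, smul_zero]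

/-- The ideal `im d` of coboundaries in the algebra of cocycles. -/
def coboundaries : Ideal D.cocycles where
  carrier := {z | ∃ a, D.d a = z}
  zero_mem' := ⟨0, by simp⟩
  add_mem' := by
    rintro _ _ ⟨a, ha⟩ ⟨b, hb⟩
    exact ⟨a + b, by rw [map_add, ha, hb]; rfl⟩
  smul_mem' := by
    rintro ⟨z, hz⟩ ⟨_, hw⟩ ⟨a, rfl⟩
    have hz' : D.d z = 0 := hz
    refine ⟨D.parity z * a, ?_⟩
    rw [D.d_mul, D.d_parity, hz', D.parity_parity]
    simp

instance : D.coboundaries.IsTwoSided where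
  mul_mem_of_left := by
    rintro ⟨_, hw⟩ ⟨z, hz⟩ ⟨a, rfl⟩
    have hz' : D.d z = 0 := hz
    refine ⟨a * z, ?_⟩
    rw [D.d_mul, hz']
    simp

/-- The cohomology algebra `H(A, d) = ker d / im d`. -/
abbrev Cohomology : Type _ := D.cocycles ⧸ D.coboundaries

/-- The cohomology class `[z]` of a cocycle `z`. -/
def cls (z : A) (hz : D.d z = 0) : D.Cohomology :=
  Ideal.Quotient.mk D.coboundaries ⟨z, hz⟩

/-- The two-sided ideal of `A` generated by a set `s`. -/
abbrev idealOf (s : Set A) : Ideal A := (TwoSidedIdeal.span s).asIdeal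

theorem parity_mem {s : Set A} (hs : ∀ x ∈ s, D.parity x = x ∧ D.d x = 0) {x : A}
    (hx : x ∈ idealOf s) : D.parity x ∈ idealOf s := by
  rw [TwoSidedIdeal.mem_asIdeal] at hx ⊢
  induction hx using TwoSidedIdeal.span_induction with
  | mem x h => rw [(hs x h).1]; exact TwoSidedIdeal.subset_span h
  | zero => rw [map_zero]; exact zero_mem _
  | add x y _ _ ihx ihy => rw [map_add]; exact add_mem ihx ihy
  | neg x _ ih => rw [map_neg]; exact neg_mem ih
  | left_absorb a x _ ih => rw [map_mul]; exact TwoSidedIdeal.mul_mem_left _ _ _ ih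
  | right_absorb b x _ ih => rw [map_mul]; exact TwoSidedIdeal.mul_mem_right _ _ _ ih

theorem d_mem {s : Set A} (hs : ∀ x ∈ s, D.parity x = x ∧ D.d x = 0) {x : A}
    (hx : x ∈ idealOf s) : D.d x ∈ idealOf s := by
  have key : D.parity x ∈ TwoSidedIdeal.span s ∧ D.d x ∈ TwoSidedIdeal.span s := by
    rw [TwoSidedIdeal.mem_asIdeal] at hx
    refine ⟨D.parity_mem hs (TwoSidedIdeal.mem_asIdeal.2 hx) |> TwoSidedIdeal.mem_asIdeal.1, ?_⟩
    induction hx using TwoSidedIdeal.span_induction with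
    | mem x h => rw [(hs x h).2]; exact zero_mem _
    | zero => rw [map_zero]; exact zero_mem _
    | add x y _ _ ihx ihy => rw [map_add]; exact add_mem ihx ihy
    | neg x _ ih => rw [map_neg]; exact neg_mem ih
    | left_absorb a x hx ih =>
      rw [D.d_mul]
      exact add_mem (TwoSidedIdeal.mul_mem_left _ _ _ hx) (TwoSidedIdeal.mul_mem_left _ _ _ ih)
    | right_absorb b x hx ih =>
      rw [D.d_mul]
      exact add_mem (TwoSidedIdeal.mul_mem_right _ _ _ ih)
        (TwoSidedIdeal.mul_mem_right _ _ _
          (TwoSidedIdeal.mem_asIdeal.1 (D.parity_mem hs (TwoSidedIdeal.mem_asIdeal.2 hx))))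
  exact TwoSidedIdeal.mem_asIdeal.2 key.2

/-- The quotient differential algebra `A / ⟨s⟩`, for a set `s` of even cocycles. -/
def quotient (s : Set A) (hs : ∀ x ∈ s, D.parity x = x ∧ D.d x = 0) :
    DiffSuperAlgebra k (A ⧸ idealOf s) where
  parity := Ideal.Quotient.liftₐ (idealOf s)
    ((Ideal.Quotient.mkₐ k (idealOf s)).comp D.parity) (fun a ha => by
      simpa using Ideal.Quotient.eq_zero_iff_mem.2 (D.parity_mem hs ha))
  d :=
    { toFun := QuotientAddGroup.map (idealOf s).toAddSubgroup (idealOf s).toAddSubgroup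
        D.d.toAddMonoidHom (fun _ ha => D.d_mem hs ha)
      map_add' := map_add _
      map_smul' := by
        rintro r ⟨a⟩
        exact congrArg (Ideal.Quotient.mk (idealOf s)) (D.d.map_smul r a) }
  parity_parity := by
    rintro ⟨a⟩
    exact congrArg (Ideal.Quotient.mk (idealOf s)) (D.parity_parity a)
  d_parity := by
    rintro ⟨a⟩
    exact congrArg (Ideal.Quotient.mk (idealOf s)) (D.d_parity a)
  d_mul := by
    rintro ⟨a⟩ ⟨b⟩
    exact congrArg (Ideal.Quotient.mk (idealOf s)) (D.d_mul a b)
  d_d := by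
    rintro ⟨a⟩
    exact congrArg (Ideal.Quotient.mk (idealOf s)) (D.d_d a)

theorem quotient_d_mk (s : Set A) (hs : ∀ x ∈ s, D.parity x = x ∧ D.d x = 0) (a : A) :
    (D.quotient s hs).d (Ideal.Quotient.mk (idealOf s) a) =
      Ideal.Quotient.mk (idealOf s) (D.d a) := rfl

theorem quotient_parity_mk (s : Set A) (hs : ∀ x ∈ s, D.parity x = x ∧ D.d x = 0) (a : A) :
    (D.quotient s hs).parity (Ideal.Quotient.mk (idealOf s) a) =
      Ideal.Quotient.mk (idealOf s) (D.parity a) := rfl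

end DiffSuperAlgebra

/-! ### The symmetric algebra -/

/-- The symmetric algebra `SV`. This is Mathlib's `SymmetricAlgebra k V`, sealed as a definition so
that all its algebraic structure comes from the two instances below. -/
def SymAlgebra (k V : Type*) [Field k] [AddCommGroup V] [Module k V] : Type _ := SymmetricAlgebra k V

namespace SymAlgebra

variable (k V : Type*) [Field k] [AddCommGroup V] [Module k V]

instance : CommRing (SymAlgebra k V) := inferInstanceAs (CommRing (SymmetricAlgebra k V))

instance : Algebra k (SymAlgebra k V) := inferInstanceAs (Algebra k (SymmetricAlgebra k V))

/-- The identification of `SymAlgebra k V` with Mathlib's symmetric algebra (the identity map). -/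
def equivSymmetricAlgebra : SymAlgebra k V ≃ₐ[k] SymmetricAlgebra k V :=
  { Equiv.refl (SymmetricAlgebra k V) with
    map_mul' := fun _ _ => rfl
    map_add' := fun _ _ => rfl
    commutes' := fun _ => rfl }

/-- The inclusion `V → SV`. -/
def ι : V →ₗ[k] SymAlgebra k V :=
  (equivSymmetricAlgebra k V).symm.toLinearMap ∘ₗ SymmetricAlgebra.ι k V

end SymAlgebra

/-! ### The Koszul algebra `SV ⊗ Cl(V, Q)` -/

section Koszul

variable {k V : Type*} [Field k] [AddCommGroup V] [Module k V]

/-- The algebra `SV ⊗ Cl(V, Q)`. For `Q = 0` this is `SV ⊗ ⋀V`. Since `SV` is purely even, the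
graded tensor product is the ordinary tensor product of algebras. The relations of
`CliffordAlgebra Q` are `x * x = Q x`. -/
abbrev KoszulAlgebra (Q : QuadraticForm k V) : Type _ :=
  SymAlgebra k V ⊗[k] CliffordAlgebra Q

theorem koszul_contractLeft_mul (Q : QuadraticForm k V) (φ : Module.Dual k V) (x y : CliffordAlgebra Q) :
    CliffordAlgebra.contractLeft φ (x * y) =
      CliffordAlgebra.contractLeft φ x * y +
        CliffordAlgebra.involute x * CliffordAlgebra.contractLeft φ y := by
  induction x using CliffordAlgebra.left_induction generalizing y with
  | algebraMap r =>
    rw [CliffordAlgebra.contractLeft_algebraMap_mul, CliffordAlgebra.contractLeft_algebraMap]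
    simp
  | add a b ha hb => rw [add_mul, map_add, map_add, map_add, ha, hb]; noncomm_ring
  | ι_mul a v ha =>
    rw [mul_assoc, CliffordAlgebra.contractLeft_ι_mul, CliffordAlgebra.contractLeft_ι_mul, ha]
    simp only [map_mul, CliffordAlgebra.involute_ι, sub_mul, mul_add, smul_mul_assoc, mul_assoc,
      neg_mul]
    abel

theorem koszul_contractLeft_involute (Q : QuadraticForm k V) (φ : Module.Dual k V)
    (x : CliffordAlgebra Q) :
    CliffordAlgebra.contractLeft φ (CliffordAlgebra.involute x) =
      -CliffordAlgebra.involute (CliffordAlgebra.contractLeft φ x) := by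
  induction x using CliffordAlgebra.left_induction with
  | algebraMap r => simp [CliffordAlgebra.contractLeft_algebraMap]
  | add a b ha hb => simp only [map_add, ha, hb]; abel
  | ι_mul a v ha =>
    simp only [map_mul, CliffordAlgebra.involute_ι, neg_mul, map_neg, map_sub, map_smul,
      CliffordAlgebra.contractLeft_ι_mul, ha]
    simp

set_option linter.unusedSectionVars false

variable [FiniteDimensional k V]

/-- The Koszul differential on `SV ⊗ Cl(V, Q)`: `f ⊗ c ↦ ∑ₐ e_a f ⊗ (e_a^* ⌟ c)`, for a basis
`e_a` of `V` with dual basis `e_a^*`. It is the unique odd derivation with `1 ⊗ x ↦ x ⊗ 1` and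
`x ⊗ 1 ↦ 0` for `x ∈ V`; see `koszulD_ι`, `koszulD_tmul_one` and `koszulD_mul`. -/
def koszulD (Q : QuadraticForm k V) : KoszulAlgebra Q →ₗ[k] KoszulAlgebra Q :=
  ∑ a, TensorProduct.map
    (LinearMap.mulLeft k (SymAlgebra.ι k V (Module.finBasis k V a)))
    (CliffordAlgebra.contractLeft ((Module.finBasis k V).coord a))

theorem koszulD_tmul (Q : QuadraticForm k V) (f : SymAlgebra k V) (c : CliffordAlgebra Q) :
    koszulD Q (f ⊗ₜ c) =
      ∑ a, (SymAlgebra.ι k V (Module.finBasis k V a) * f) ⊗ₜ[k]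
        CliffordAlgebra.contractLeft ((Module.finBasis k V).coord a) c := by
  simp [koszulD, LinearMap.sum_apply]

theorem koszulD_tmul_one (Q : QuadraticForm k V) (f : SymAlgebra k V) :
    koszulD Q (f ⊗ₜ 1) = 0 := by
  simp [koszulD_tmul, CliffordAlgebra.contractLeft_one]

theorem koszulD_ι (Q : QuadraticForm k V) (x : V) :
    koszulD Q (1 ⊗ₜ CliffordAlgebra.ι Q x) = SymAlgebra.ι k V x ⊗ₜ 1 := by
  rw [koszulD_tmul]
  simp only [CliffordAlgebra.contractLeft_ι, mul_one, Algebra.algebraMap_eq_smul_one,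
    ← TensorProduct.smul_tmul, ← TensorProduct.sum_tmul, ← map_smul, ← map_sum,
    Module.Basis.coord_apply, Module.Basis.sum_repr]

/-- The parity automorphism of `SV ⊗ Cl(V, Q)`: `SV` is even and `V ⊆ Cl(V, Q)` is odd. -/
def koszulParity (Q : QuadraticForm k V) : KoszulAlgebra Q →ₐ[k] KoszulAlgebra Q :=
  Algebra.TensorProduct.map (AlgHom.id k (SymAlgebra k V)) CliffordAlgebra.involute

theorem koszulParity_tmul (Q : QuadraticForm k V) (f : SymAlgebra k V)
    (c : CliffordAlgebra Q) :
    koszulParity Q (f ⊗ₜ c) = f ⊗ₜ CliffordAlgebra.involute c := by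
  simp [koszulParity]

theorem koszulD_mul (Q : QuadraticForm k V) (x y : KoszulAlgebra Q) :
    koszulD Q (x * y) = koszulD Q x * y + koszulParity Q x * koszulD Q y := by
  induction x using TensorProduct.induction_on with
  | zero => simp
  | add x₁ x₂ h₁ h₂ => rw [add_mul, map_add, map_add, map_add, h₁, h₂]; noncomm_ring
  | tmul f c =>
    induction y using TensorProduct.induction_on with
    | zero => simp
    | add y₁ y₂ h₁ h₂ => rw [mul_add, map_add, map_add, h₁, h₂]; noncomm_ring
    | tmul g e =>
      rw [Algebra.TensorProduct.tmul_mul_tmul, koszulD_tmul, koszulD_tmul, koszulD_tmul,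
        koszulParity_tmul, Finset.sum_mul, Finset.mul_sum, ← Finset.sum_add_distrib]
      refine Finset.sum_congr rfl fun a _ => ?_
      rw [Algebra.TensorProduct.tmul_mul_tmul, Algebra.TensorProduct.tmul_mul_tmul,
        koszul_contractLeft_mul, TensorProduct.tmul_add]
      congr 2 <;> ring

theorem koszulD_parity (Q : QuadraticForm k V) (x : KoszulAlgebra Q) :
    koszulD Q (koszulParity Q x) = -koszulParity Q (koszulD Q x) := by
  induction x using TensorProduct.induction_on with
  | zero => simp
  | add x₁ x₂ h₁ h₂ => rw [map_add, map_add, map_add, map_add, h₁, h₂]; abel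
  | tmul f c =>
    simp only [koszulParity_tmul, koszulD_tmul, map_sum, koszul_contractLeft_involute,
      TensorProduct.tmul_neg, Finset.sum_neg_distrib]

theorem koszulParity_koszulParity (Q : QuadraticForm k V) (x : KoszulAlgebra Q) :
    koszulParity Q (koszulParity Q x) = x := by
  induction x using TensorProduct.induction_on with
  | zero => simp
  | add x₁ x₂ h₁ h₂ => rw [map_add, map_add, h₁, h₂]
  | tmul f c => simp only [koszulParity_tmul, CliffordAlgebra.involute_involute]

theorem koszulD_tmul_one_mul (Q : QuadraticForm k V) (f : SymAlgebra k V)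
    (y : KoszulAlgebra Q) : koszulD Q (f ⊗ₜ 1 * y) = f ⊗ₜ 1 * koszulD Q y := by
  rw [koszulD_mul, koszulD_tmul_one, koszulParity_tmul]
  simp

theorem koszulD_koszulD (Q : QuadraticForm k V) (x : KoszulAlgebra Q) :
    koszulD Q (koszulD Q x) = 0 := by
  induction x using TensorProduct.induction_on with
  | zero => simp
  | add x₁ x₂ h₁ h₂ => rw [map_add, map_add, h₁, h₂, add_zero]
  | tmul f c =>
    induction c using CliffordAlgebra.left_induction generalizing f with
    | algebraMap r =>
      rw [Algebra.algebraMap_eq_smul_one, ← TensorProduct.smul_tmul, koszulD_tmul_one, map_zero]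
    | add a b ha hb => rw [TensorProduct.tmul_add, map_add, map_add, ha, hb, add_zero]
    | ι_mul c v hc =>
      have h : f ⊗ₜ[k] (CliffordAlgebra.ι Q v * c) =
          ((1 : SymAlgebra k V) ⊗ₜ[k] CliffordAlgebra.ι Q v) * (f ⊗ₜ[k] c) := by
        rw [Algebra.TensorProduct.tmul_mul_tmul, one_mul]
      rw [h, koszulD_mul, koszulD_ι, map_add, koszulD_tmul_one_mul, koszulD_mul,
        koszulD_parity, koszulD_ι, hc, koszulParity_tmul, koszulParity_tmul]
      simp [TensorProduct.tmul_neg]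

/-- The Koszul differential algebra `𝒦(V, Q) = SV ⊗ Cl(V, Q)`. -/
def koszul (Q : QuadraticForm k V) : DiffSuperAlgebra k (KoszulAlgebra Q) where
  parity := koszulParity Q
  d := koszulD Q
  parity_parity := koszulParity_koszulParity Q
  d_parity := koszulD_parity Q
  d_mul := koszulD_mul Q
  d_d := koszulD_koszulD Q

/-- The generators `p_i ⊗ 1` of the ideal `⟨S⁺P⟩` of `𝒦(V, Q)`. -/
def koszulGen (Q : QuadraticForm k V) {n : ℕ} (p : Fin n → SymAlgebra k V) :
    Set (KoszulAlgebra Q) :=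
  Set.range fun i => p i ⊗ₜ[k] (1 : CliffordAlgebra Q)

/-- The differential algebra `𝒦(V, Q) / ⟨S⁺P⟩`, where `⟨S⁺P⟩` is the ideal generated by the
elements `p_i ⊗ 1`. -/
def koszulQuot (Q : QuadraticForm k V) {n : ℕ} (p : Fin n → SymAlgebra k V) :
    DiffSuperAlgebra k (KoszulAlgebra Q ⧸ DiffSuperAlgebra.idealOf (koszulGen Q p)) :=
  (koszul Q).quotient (koszulGen Q p) (by
    rintro _ ⟨i, rfl⟩
    exact ⟨by simp [koszul, koszulParity_tmul], koszulD_tmul_one Q (p i)⟩)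

/-- `C` is a cochain of transgression for `f ∈ SV`: an odd element with `dC = f ⊗ 1`. -/
def IsTransgressionCochain (Q : QuadraticForm k V) (f : SymAlgebra k V)
    (C : KoszulAlgebra Q) : Prop :=
  (koszul Q).parity C = -C ∧ (koszul Q).d C = f ⊗ₜ 1

/-- `[C] ∈ H(𝒦(V, Q) / ⟨S⁺P⟩)` is the element `c`: the image of `C` in the quotient is a
cocycle whose class is `c`. -/
def HasQuotClass (Q : QuadraticForm k V) {n : ℕ} (p : Fin n → SymAlgebra k V)
    (C : KoszulAlgebra Q) (c : (koszulQuot Q p).Cohomology) : Prop :=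
  ∃ h : (koszulQuot Q p).d (Ideal.Quotient.mk _ C) = 0, (koszulQuot Q p).cls _ h = c

/-- `[z] ∈ H(𝒦(V, Q))` is the scalar `r ∈ k`: `z` is a cocycle whose class is `r` times the
unit of the cohomology algebra. -/
def HasScalarClass (Q : QuadraticForm k V) (z : KoszulAlgebra Q) (r : k) : Prop :=
  ∃ h : (koszul Q).d z = 0, (koszul Q).cls z h = algebraMap k (koszul Q).Cohomology r

end Koszul

/-! ### Polynomials, reflection groups and invariants -/

section Invariants

variable {k V : Type*} [Field k] [AddCommGroup V] [Module k V]

/-- The homogeneous elements of degree `m` of `SV`: sums of products of `m` vectors. -/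
def symDegree (k V : Type*) [Field k] [AddCommGroup V] [Module k V] (m : ℕ) :
    Submodule k (SymAlgebra k V) :=
  LinearMap.range (SymAlgebra.ι k V) ^ m

/-- A basis `e` of `V` identifies `SV` with the polynomial algebra in the variables `e_a`. -/
def symEquivMvPolynomial {ι : Type*} (e : Module.Basis ι k V) : SymAlgebra k V ≃ₐ[k] MvPolynomial ι k :=
  (SymAlgebra.equivSymmetricAlgebra k V).trans (SymmetricAlgebra.equivMvPolynomial e)

/-- The partial derivative `∂f/∂e_a` of `f ∈ SV` for a basis `e` of `V`, where `SV` is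
the polynomial algebra in the variables `e_a`. -/
def partialD {ι : Type*} (e : Module.Basis ι k V) (a : ι) (f : SymAlgebra k V) :
    SymAlgebra k V :=
  (symEquivMvPolynomial e).symm (MvPolynomial.pderiv a (symEquivMvPolynomial e f))

/-- The algebra endomorphism of `SV` induced by a linear automorphism of `V`. -/
def symMap (g : V ≃ₗ[k] V) : SymAlgebra k V →ₐ[k] SymAlgebra k V :=
  (SymmetricAlgebra.lift (SymAlgebra.ι k V ∘ₗ g.toLinearMap)).comp
    (SymAlgebra.equivSymmetricAlgebra k V).toAlgHom

/-- The algebra `(SV)^W` of invariants. -/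
def invariants (W : Subgroup (V ≃ₗ[k] V)) : Subalgebra k (SymAlgebra k V) where
  carrier := {f | ∀ g ∈ W, symMap g f = f}
  mul_mem' := fun ha hb g hg => by rw [map_mul, ha g hg, hb g hg]
  add_mem' := fun ha hb g hg => by rw [map_add, ha g hg, hb g hg]
  algebraMap_mem' := fun r g _ => AlgHom.commutes _ r

/-- A (possibly complex, in Bourbaki's terminology pseudo-) reflection: an automorphism `g` such
that `g - 1` has rank one. Euclidean reflections are of this kind. -/
def IsReflectionMap (g : V ≃ₗ[k] V) : Prop :=
  Module.finrank k (LinearMap.range (g.toLinearMap - LinearMap.id)) = 1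

/-- A finite reflection group: a finite group of automorphisms of `V` generated by reflections. -/
def IsFiniteReflectionGroup (W : Subgroup (V ≃ₗ[k] V)) : Prop :=
  Finite W ∧ Subgroup.closure {g | g ∈ W ∧ IsReflectionMap g} = W

/-- `p_1, …, p_n` are algebraically independent homogeneous generators of the algebra `(SV)^W`,
with `p_i` of degree `m_i`. -/
structure IsInvariantGenerators (W : Subgroup (V ≃ₗ[k] V)) {n : ℕ}
    (p : Fin n → SymAlgebra k V) (m : Fin n → ℕ) : Prop where
  homogeneous : ∀ i, p i ∈ symDegree k V (m i)
  algebraicIndependent : AlgebraicIndependent k p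
  adjoin_eq : Algebra.adjoin k (Set.range p) = invariants W

/-- The element `(1 / m) ∑ₐ ∂f/∂e_a ⊗ e_a` of `SV ⊗ Cl(V, Q)`. -/
def transgressionCochain {ι : Type*} [Fintype ι] (e : Module.Basis ι k V) (Q : QuadraticForm k V)
    (m : ℕ) (f : SymAlgebra k V) : KoszulAlgebra Q :=
  (m : k)⁻¹ • ∑ a, partialD e a f ⊗ₜ[k] CliffordAlgebra.ι Q (e a)

end Invariants

end

/-! Write `S` for `SV` and `R` for the invariants. Four facts carry the theorem.

Reflection groups. If `s` is a reflection, every `s f - f` is divisible by one linear form.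
Chevalley's lemma `sum_coeff_mul_mem_hilbertIdeal` uses this to turn a syzygy with invariant
coefficients into a relation with constant coefficients modulo the ideal generated by invariants
without constant term. Applied to monomials that form a basis modulo that ideal, it shows that `S`
is free over `R`. Applied to the derivatives of homogeneous lifts of a basis of the indecomposable
invariants, it shows that these lifts are algebraically independent. Integrality of `S` over `R`
fixes their number.

Acyclicity. For the zero form, Cartan's homotopy formula makes the total degree operator
null-homotopic, so in characteristic zero only scalars survive. A general form reduces to this one
by a linear change of form that commutes with contractions. The scalar represented by a cocycle is
read off by the augmentation `SV ⊗ Cl → Cl`.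

Transgression. Euler's identity yields explicit cochains. Two cochains for the same element differ
by an odd cocycle, hence by a coboundary. The augmentation therefore sends every cochain for `p` in
`P` to the linear part of `p` in `V`, and `B` is `B_V` evaluated on linear parts.

The quotient. Since `R` is the polynomial algebra on the `p i` and the Koszul algebra is free over
`R`, the `p i` form a regular sequence on it. Each is the coboundary of the odd `C i`, and dividing
by `p i` adjoins the class of `C i` to the cohomology. Inductively the ordered products of the `C i`
form a basis (`exists_sub_mem`, `eq_zero_of_sub_mem`), and the map from `Cl(P, B)` given by its
universal property matches ordered products with ordered products. -/

noncomputable section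

set_option linter.unusedSectionVars false

/-! ### Reflection groups acting on polynomials, and Chevalley's lemma -/

namespace MvPolynomial

section InvariantTheory

variable {σ k : Type*} [Field k]

/-- Any splitting of `μ` other than `(μ, 0)` evaluates `r` at an exponent of smaller degree. -/
theorem coeff_mul_of_coeff_eq_zero_of_degree_lt {r f : MvPolynomial σ k} {μ : σ →₀ ℕ}
    (hr : ∀ ν : σ →₀ ℕ, ν.degree < μ.degree → coeff ν r = 0) :
    coeff μ (r * f) = coeff μ r * coeff 0 f := by
  classical
  rw [coeff_mul, Finset.sum_eq_single (μ, 0)]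
  · rintro ⟨a, b⟩ hab hne
    rw [Finset.HasAntidiagonal.mem_antidiagonal] at hab
    have hb : b ≠ 0 := by
      rintro rfl
      exact hne (by simpa using hab)
    have hdeg : a.degree + b.degree = μ.degree := by
      rw [← hab]; exact (map_add Finsupp.degree a b).symm
    have hb' : b.degree ≠ 0 := fun h => hb ((Finsupp.degree_eq_zero_iff b).1 h)
    rw [hr a (by omega), zero_mul]
  · intro h
    simp at h

variable {G : Type*} [Group G] [MulSemiringAction G (MvPolynomial σ k)]
  [SMulCommClass G k (MvPolynomial σ k)]

variable (σ k G) in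
/-- The action of `G` on polynomials preserves homogeneity. -/
def IsGradedAction : Prop :=
  ∀ (g : G) (n : ℕ) (f : MvPolynomial σ k), f.IsHomogeneous n → (g • f).IsHomogeneous n

variable (σ k G) in
/-- `G` is generated by elements `s` such that all `s • f - f` are divisible by a common nonzero
linear form. -/
def IsGeneratedByReflections : Prop :=
  Subgroup.closure {s : G | ∃ u : MvPolynomial σ k, u.IsHomogeneous 1 ∧ u ≠ 0 ∧
    ∀ f : MvPolynomial σ k, u ∣ s • f - f} = ⊤

variable (σ k G) in
/-- The ideal generated by the invariants without constant term. -/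
def hilbertIdeal : Ideal (MvPolynomial σ k) :=
  Ideal.span {r | r ∈ FixedPoints.subalgebra k (MvPolynomial σ k) G ∧ coeff 0 r = 0}

theorem smul_C (g : G) (c : k) : g • (C c : MvPolynomial σ k) = C c := by
  rw [← algebraMap_eq]
  exact smul_algebraMap g c

theorem smul_homogeneousComponent (hG : IsGradedAction σ k G) (g : G) (n : ℕ)
    (f : MvPolynomial σ k) :
    g • homogeneousComponent n f = homogeneousComponent n (g • f) := by
  conv_rhs => rw [← sum_homogeneousComponent f, Finset.smul_sum, map_sum]
  have h : ∀ i, homogeneousComponent n (g • homogeneousComponent i f) =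
      if i = n then g • homogeneousComponent i f else 0 := fun i => by
    rw [homogeneousComponent_of_mem (hG g i _ (homogeneousComponent_isHomogeneous i f))]
    simp only [eq_comm]
  simp only [h, Finset.sum_ite_eq', Finset.mem_range]
  split_ifs with hn
  · rfl
  · rw [homogeneousComponent_eq_zero _ _ (by omega), smul_zero]

theorem coeff_zero_smul (hG : IsGradedAction σ k G) (g : G) (f : MvPolynomial σ k) :
    coeff 0 (g • f) = coeff 0 f := by
  have h := smul_homogeneousComponent hG g 0 f
  rw [homogeneousComponent_zero, homogeneousComponent_zero, smul_C] at h
  exact (C_injective σ k h).symm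

theorem totalDegree_group_smul_le (hG : IsGradedAction σ k G) (g : G) (f : MvPolynomial σ k) :
    (g • f).totalDegree ≤ f.totalDegree := by
  conv_lhs => rw [← sum_homogeneousComponent f, Finset.smul_sum]
  refine totalDegree_finsetSum_le fun i hi => ?_
  exact (hG g i _ (homogeneousComponent_isHomogeneous i f)).totalDegree_le.trans
    (Nat.lt_succ_iff.1 (Finset.mem_range.1 hi))

theorem homogeneousComponent_mem_fixedPoints (hG : IsGradedAction σ k G) (n : ℕ)
    {f : MvPolynomial σ k} (hf : f ∈ FixedPoints.subalgebra k (MvPolynomial σ k) G) :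
    homogeneousComponent n f ∈ FixedPoints.subalgebra k (MvPolynomial σ k) G := fun g => by
  rw [smul_homogeneousComponent hG, hf g]

theorem smul_mem_hilbertIdeal (g : G) {f : MvPolynomial σ k} (hf : f ∈ hilbertIdeal σ k G) :
    g • f ∈ hilbertIdeal σ k G := by
  induction hf using Submodule.span_induction with
  | mem x hx => rw [hx.1 g]; exact Ideal.subset_span hx
  | zero => rw [smul_zero]; exact zero_mem _
  | add x y _ _ hx hy => rw [smul_add]; exact add_mem hx hy
  | smul a x _ hx => rw [smul_eq_mul, smul_mul']; exact Ideal.mul_mem_left _ _ hx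

/-- The Hilbert ideal is stable under `G`, so the elements fixing `f` modulo it form a subgroup. -/
theorem smul_sub_mem_hilbertIdeal_of_reflections (hG : IsGeneratedByReflections σ k G)
    {f : MvPolynomial σ k}
    (hf : ∀ (s : G) (u : MvPolynomial σ k), u.IsHomogeneous 1 → u ≠ 0 →
      (∀ f : MvPolynomial σ k, u ∣ s • f - f) → s • f - f ∈ hilbertIdeal σ k G) (g : G) :
    g • f - f ∈ hilbertIdeal σ k G := by
  have hg : g ∈ Subgroup.closure {s : G | ∃ u : MvPolynomial σ k, u.IsHomogeneous 1 ∧ u ≠ 0 ∧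
    ∀ f : MvPolynomial σ k, u ∣ s • f - f} := by
    rw [show Subgroup.closure _ = _ from hG]; trivial
  induction hg using Subgroup.closure_induction with
  | mem s hs =>
    obtain ⟨u, h1, h2, h3⟩ := hs
    exact hf s u h1 h2 h3
  | one => simp
  | mul a b _ _ ha hb =>
    have := add_mem (smul_mem_hilbertIdeal a hb) ha
    rwa [smul_sub, smul_smul, sub_add_sub_cancel] at this
  | inv a _ ha =>
    have := neg_mem (smul_mem_hilbertIdeal a⁻¹ ha)
    rwa [smul_sub, smul_smul, inv_mul_cancel, one_smul, neg_sub] at this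

section Reynolds

variable [Fintype G]

variable (G) in
/-- The Reynolds operator: averaging over the group. -/
def reynolds : MvPolynomial σ k →ₗ[k] MvPolynomial σ k :=
  (Fintype.card G : k)⁻¹ • ∑ g : G, DistribSMul.toLinearMap k (MvPolynomial σ k) g

theorem reynolds_apply (f : MvPolynomial σ k) :
    reynolds G f = (Fintype.card G : k)⁻¹ • ∑ g : G, g • f := by
  simp [reynolds, LinearMap.sum_apply]

theorem reynolds_mem (f : MvPolynomial σ k) :
    reynolds G f ∈ FixedPoints.subalgebra k (MvPolynomial σ k) G := fun g => by
  rw [reynolds_apply, smul_comm, Finset.smul_sum]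
  simp only [smul_smul]
  congr 1
  exact Fintype.sum_bijective (g * ·) (Group.mulLeft_bijective g) _ _ fun _ => rfl

theorem reynolds_mul {r : MvPolynomial σ k}
    (hr : r ∈ FixedPoints.subalgebra k (MvPolynomial σ k) G) (f : MvPolynomial σ k) :
    reynolds G (r * f) = r * reynolds G f := by
  rw [reynolds_apply, reynolds_apply, mul_smul_comm, Finset.mul_sum]
  congr 1
  exact Finset.sum_congr rfl fun g _ => by rw [smul_mul', hr g]

variable [CharZero k]

theorem reynolds_eq_self {r : MvPolynomial σ k}
    (hr : r ∈ FixedPoints.subalgebra k (MvPolynomial σ k) G) : reynolds G r = r := by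
  rw [reynolds_apply, Finset.sum_congr rfl fun g _ => hr g, Finset.sum_const, Finset.card_univ,
    ← Nat.cast_smul_eq_nsmul k, smul_smul, inv_mul_cancel₀, one_smul]
  exact Nat.cast_ne_zero.2 Fintype.card_ne_zero

theorem coeff_zero_reynolds (hG : IsGradedAction σ k G) (f : MvPolynomial σ k) :
    coeff 0 (reynolds G f) = coeff 0 f := by
  rw [reynolds_apply, coeff_smul, coeff_sum,
    Finset.sum_congr rfl fun g _ => coeff_zero_smul hG g f, Finset.sum_const, Finset.card_univ,
    nsmul_eq_mul, smul_eq_mul, inv_mul_cancel_left₀]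
  exact Nat.cast_ne_zero.2 Fintype.card_ne_zero

theorem reynolds_sub_mem_hilbertIdeal {f : MvPolynomial σ k}
    (hf : ∀ g : G, g • f - f ∈ hilbertIdeal σ k G) :
    reynolds G f - f ∈ hilbertIdeal σ k G := by
  have h : reynolds G f - f = (Fintype.card G : k)⁻¹ • ∑ g : G, (g • f - f) := by
    rw [Finset.sum_sub_distrib, smul_sub, ← reynolds_apply, Finset.sum_const, Finset.card_univ,
      ← Nat.cast_smul_eq_nsmul k, smul_smul, inv_mul_cancel₀, one_smul]
    exact Nat.cast_ne_zero.2 Fintype.card_ne_zero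
  rw [h, smul_eq_C_mul]
  exact Ideal.mul_mem_left _ _ (sum_mem fun g _ => hf g)

/-- Chevalley's lemma: a syzygy `∑ rᵢ gᵢ = 0` with invariant `rᵢ` gives, on replacing the `rᵢ` by
their coefficients at a monomial of lowest degree, a relation modulo the Hilbert ideal. -/
theorem sum_coeff_mul_mem_hilbertIdeal (hG : IsGradedAction σ k G)
    (hR : IsGeneratedByReflections σ k G) {ι : Type*} (s : Finset ι) (r : ι → MvPolynomial σ k)
    (hr : ∀ i ∈ s, r i ∈ FixedPoints.subalgebra k (MvPolynomial σ k) G) (μ : σ →₀ ℕ)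
    (hμ : ∀ i ∈ s, ∀ ν : σ →₀ ℕ, ν.degree < μ.degree → coeff ν (r i) = 0)
    (g : ι → MvPolynomial σ k) (h : ∑ i ∈ s, r i * g i = 0) :
    ∑ i ∈ s, C (coeff μ (r i)) * g i ∈ hilbertIdeal σ k G := by
  -- Induction on a strict bound for the degrees of the nonzero `g i`; at `d = 0` all of them
  -- vanish.
  obtain ⟨d, hd⟩ : ∃ d : ℕ, ∀ i ∈ s, g i ≠ 0 → (g i).totalDegree < d :=
    ⟨(s.sup fun i => (g i).totalDegree) + 1, fun i hi _ =>
      Nat.lt_succ_iff.2 (Finset.le_sup (f := fun i => (g i).totalDegree) hi)⟩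
  induction d generalizing g with
  | zero =>
    rw [Finset.sum_eq_zero]
    · exact zero_mem _
    · intro i hi
      have : g i = 0 := by
        by_contra h0
        exact absurd (hd i hi h0) (Nat.not_lt_zero _)
      rw [this, mul_zero]
  | succ d ih =>
    -- For a reflection `t`, subtracting the syzygy from its translate and cancelling the linear
    -- form `u` gives a syzygy for the quotients `q i`, which have smaller degree. Hence the sum is
    -- invariant modulo the ideal and may be replaced by its average.
    have hinv : ∀ t : G, t • (∑ i ∈ s, C (coeff μ (r i)) * g i) -
        ∑ i ∈ s, C (coeff μ (r i)) * g i ∈ hilbertIdeal σ k G := by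
      refine smul_sub_mem_hilbertIdeal_of_reflections hR fun t u hu hu0 hdiv => ?_
      choose q hq using fun i => hdiv (g i)
      have e : t • (∑ i ∈ s, C (coeff μ (r i)) * g i) - ∑ i ∈ s, C (coeff μ (r i)) * g i =
          u * ∑ i ∈ s, C (coeff μ (r i)) * q i := by
        rw [Finset.smul_sum, ← Finset.sum_sub_distrib, Finset.mul_sum]
        refine Finset.sum_congr rfl fun i _ => ?_
        rw [smul_mul', smul_C, ← mul_sub, hq i]
        ring
      rw [e]
      refine Ideal.mul_mem_left _ _ (ih q ?_ ?_)
      · have e' : u * ∑ i ∈ s, r i * q i = 0 := by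
          have : t • (∑ i ∈ s, r i * g i) - ∑ i ∈ s, r i * g i = u * ∑ i ∈ s, r i * q i := by
            rw [Finset.smul_sum, ← Finset.sum_sub_distrib, Finset.mul_sum]
            refine Finset.sum_congr rfl fun i hi => ?_
            rw [smul_mul', hr i hi t, ← mul_sub, hq i]
            ring
          rw [← this, h, smul_zero, sub_zero]
        exact (mul_eq_zero.1 e').resolve_left hu0
      · intro i hi hqi
        have hgi : g i ≠ 0 := by
          intro h0
          have := hq i
          rw [h0, smul_zero, sub_zero] at this
          exact (mul_ne_zero hu0 hqi) this.symm
        have h1 := totalDegree_mul_of_isDomain hu0 hqi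
        rw [hu.totalDegree hu0, ← hq i] at h1
        have h2 := totalDegree_sub (t • g i) (g i)
        rw [max_eq_right (totalDegree_group_smul_le hG t (g i))] at h2
        have := hd i hi hgi
        omega
    have hrey := reynolds_sub_mem_hilbertIdeal hinv
    have hmem : reynolds G (∑ i ∈ s, C (coeff μ (r i)) * g i) ∈ hilbertIdeal σ k G := by
      have e : reynolds G (∑ i ∈ s, C (coeff μ (r i)) * g i) =
          ∑ i ∈ s, C (coeff μ (r i)) * (reynolds G (g i) - C (coeff 0 (reynolds G (g i)))) := by
        -- The coefficient at `μ` of the averaged syzygy sees only the constant terms of the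
        -- averages. These can therefore be subtracted, leaving invariants without constant term.
        have hz : ∑ i ∈ s, coeff μ (r i) * coeff 0 (reynolds G (g i)) = 0 := by
          have h0 : reynolds G (∑ i ∈ s, r i * g i) = ∑ i ∈ s, r i * reynolds G (g i) := by
            rw [map_sum]
            exact Finset.sum_congr rfl fun i hi => reynolds_mul (hr i hi) _
          rw [h, map_zero] at h0
          have h1 := congrArg (coeff μ) h0
          rw [coeff_zero, coeff_sum] at h1
          rw [h1]
          exact Finset.sum_congr rfl fun i hi =>
            (coeff_mul_of_coeff_eq_zero_of_degree_lt (hμ i hi)).symm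
        have hz' : ∑ i ∈ s, (C (coeff μ (r i)) * C (coeff 0 (reynolds G (g i))) :
            MvPolynomial σ k) = 0 := by
          simp only [← C_mul, ← map_sum, hz, C_0]
        simp only [mul_sub, Finset.sum_sub_distrib]
        rw [map_sum, hz', sub_zero]
        refine Finset.sum_congr rfl fun i _ => ?_
        rw [← smul_eq_C_mul, ← smul_eq_C_mul, map_smul]
      rw [e]
      refine sum_mem fun i _ => Ideal.mul_mem_left _ _ (Ideal.subset_span ⟨?_, ?_⟩)
      · exact sub_mem (reynolds_mem _)
          (by rw [← algebraMap_eq]; exact Subalgebra.algebraMap_mem _ _)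
      · simp
    have := sub_mem hmem hrey
    rwa [sub_sub_cancel] at this

end Reynolds

end InvariantTheory

/-! ### Freeness of the polynomial algebra over the invariants -/

section InvariantTheory

variable {σ k : Type*} [Field k]

theorem homogeneousComponent_mul_mem {M : AddSubmonoid (MvPolynomial σ k)} (n : ℕ)
    (x y : MvPolynomial σ k)
    (h : ∀ i j, i + j = n → homogeneousComponent i x * homogeneousComponent j y ∈ M) :
    homogeneousComponent n (x * y) ∈ M := by
  rw [← sum_homogeneousComponent x, ← sum_homogeneousComponent y, Finset.sum_mul_sum, map_sum]
  refine sum_mem fun i _ => ?_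
  rw [map_sum]
  refine sum_mem fun j _ => ?_
  rw [homogeneousComponent_of_mem ((homogeneousComponent_isHomogeneous i x).mul
    (homogeneousComponent_isHomogeneous j y))]
  split_ifs with hij
  · exact h i j hij.symm
  · exact zero_mem _

theorem homogeneousComponent_mem_span_range {κ : Type*} {f : κ → MvPolynomial σ k} {m : κ → ℕ}
    (hf : ∀ j, (f j).IsHomogeneous (m j)) (n : ℕ) {w : MvPolynomial σ k}
    (hw : w ∈ Submodule.span k (Set.range f)) :
    homogeneousComponent n w ∈ Submodule.span k (Set.range f) := by
  refine (Submodule.span_le (p := (Submodule.span k (Set.range f)).comap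
    (homogeneousComponent n))).2 ?_ hw
  rintro _ ⟨j, rfl⟩
  rw [SetLike.mem_coe, Submodule.mem_comap, homogeneousComponent_of_mem (hf j)]
  split_ifs
  · exact Submodule.subset_span ⟨j, rfl⟩
  · exact zero_mem _

variable {G : Type*} [Group G] [MulSemiringAction G (MvPolynomial σ k)]
  [SMulCommClass G k (MvPolynomial σ k)]

/-- A generator of the ideal has only components of positive degree, so in degree `n` it is
multiplied by polynomials of degree below `n`, to which `hN` applies. -/
theorem homogeneousComponent_mem_of_mem_hilbertIdeal (hG : IsGradedAction σ k G) {n : ℕ}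
    {N : Submodule (FixedPoints.subalgebra k (MvPolynomial σ k) G) (MvPolynomial σ k)}
    (hN : ∀ m < n, ∀ f : MvPolynomial σ k, f.IsHomogeneous m → f ∈ N)
    {x : MvPolynomial σ k} (hx : x ∈ hilbertIdeal σ k G) : homogeneousComponent n x ∈ N := by
  suffices h : ∀ a : MvPolynomial σ k, homogeneousComponent n (a * x) ∈ N by
    simpa using h 1
  induction hx using Submodule.span_induction with
  | mem r hr =>
    intro a
    refine homogeneousComponent_mul_mem (M := N.toAddSubmonoid) n a r fun i j hij => ?_
    rcases Nat.eq_zero_or_pos j with rfl | hj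
    · rw [homogeneousComponent_zero, hr.2, C_0, mul_zero]; exact zero_mem _
    · rw [mul_comm]
      exact N.smul_mem ⟨_, homogeneousComponent_mem_fixedPoints hG j hr.1⟩
        (hN i (by omega) _ (homogeneousComponent_isHomogeneous i a))
  | zero => intro a; simp
  | add x y _ _ hx hy => intro a; rw [mul_add, map_add]; exact add_mem (hx a) (hy a)
  | smul b x _ hx => intro a; rw [smul_eq_mul, ← mul_assoc]; exact hx _

variable [Fintype G] [CharZero k]

/-- The polynomial algebra is free over the invariants of a finite reflection group. -/
theorem free_fixedPoints (hG : IsGradedAction σ k G) (hR : IsGeneratedByReflections σ k G) :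
    Module.Free (FixedPoints.subalgebra k (MvPolynomial σ k) G) (MvPolynomial σ k) := by
  classical
  let q := ((hilbertIdeal σ k G).restrictScalars k).mkQ
  -- Monomials whose classes form a `k`-basis modulo the Hilbert ideal; being homogeneous, they suit
  -- an induction on degree.
  obtain ⟨κ, a, -, hsp, hli⟩ := exists_linearIndependent' k
    (fun μ : σ →₀ ℕ => q (monomial μ (1 : k)))
  let b : κ → MvPolynomial σ k := fun j => monomial (a j) 1
  have hb : ∀ j, (b j).IsHomogeneous (a j).degree := fun j => isHomogeneous_monomial 1 rfl
  have hind : LinearIndependent (FixedPoints.subalgebra k (MvPolynomial σ k) G) b := by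
    rw [linearIndependent_iff']
    intro s g hg
    by_contra! hne
    obtain ⟨i₀, hi₀, hgi₀⟩ := hne
    -- Chevalley's lemma is applied at an exponent `μ` of least degree among those occurring in the
    -- coefficients `g i`.
    have hex : ∃ d : ℕ, ∃ μ : σ →₀ ℕ, μ.degree = d ∧ ∃ i ∈ s, coeff μ (g i).1 ≠ 0 := by
      obtain ⟨μ, hμ⟩ := ne_zero_iff.1 (fun h => hgi₀ (Subtype.ext h))
      exact ⟨_, μ, rfl, i₀, hi₀, hμ⟩
    obtain ⟨μ, hμd, i₁, hi₁, hμ⟩ := Nat.find_spec hex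
    have key := sum_coeff_mul_mem_hilbertIdeal hG hR s (fun i => (g i).1) (fun i _ => (g i).2) μ
      (fun i hi ν hν => by
        by_contra h0
        exact Nat.find_min hex (hμd ▸ hν) ⟨ν, rfl, i, hi, h0⟩) b hg
    have key' : ∑ i ∈ s, coeff μ (g i).1 • q (b i) = 0 := by
      simp only [← map_smul, ← map_sum, smul_eq_C_mul]
      exact (Submodule.Quotient.mk_eq_zero _).2 key
    exact hμ (linearIndependent_iff'.1 hli s (fun i => coeff μ (g i).1) key' i₁ hi₁)
  -- Graded Nakayama: `f` is a combination of the `b j` modulo the ideal, and the degree `n`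
  -- component of the error is handled by induction.
  have hspan : ∀ n : ℕ, ∀ f : MvPolynomial σ k, f.IsHomogeneous n →
      f ∈ Submodule.span (FixedPoints.subalgebra k (MvPolynomial σ k) G) (Set.range b) := by
    intro n
    induction n using Nat.strong_induction_on with
    | _ n ih =>
      intro f hf
      have hmem : q f ∈ (Submodule.span k (Set.range b)).map q := by
        rw [Submodule.map_span, ← Set.range_comp]
        change q f ∈ Submodule.span k (Set.range ((fun μ => q (monomial μ (1 : k))) ∘ a))
        rw [hsp]
        rw [f.as_sum, map_sum]
        refine sum_mem fun μ _ => ?_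
        rw [← mul_one (coeff μ f), ← smul_eq_mul, ← smul_monomial, map_smul]
        exact Submodule.smul_mem _ _ (Submodule.subset_span ⟨μ, rfl⟩)
      obtain ⟨w, hw, hwf⟩ := hmem
      have hI : f - w ∈ hilbertIdeal σ k G := by
        have : q (f - w) = 0 := by rw [map_sub, hwf, sub_self]
        exact (Submodule.Quotient.mk_eq_zero _).1 this
      have h1 := homogeneousComponent_mem_of_mem_hilbertIdeal hG ih hI
      have h2 : homogeneousComponent n w ∈
          Submodule.span (FixedPoints.subalgebra k (MvPolynomial σ k) G) (Set.range b) :=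
        Submodule.span_le_restrictScalars k _ _ (homogeneousComponent_mem_span_range hb n hw)
      have h3 := add_mem h1 h2
      rwa [← map_add, sub_add_cancel, homogeneousComponent_eq_self hf] at h3
  exact Module.Free.of_basis (Module.Basis.mk hind fun f _ => by
    rw [← sum_homogeneousComponent f]
    exact sum_mem fun i _ => hspan i _ (homogeneousComponent_isHomogeneous i f))

end InvariantTheory

/-! ### The invariants form a polynomial algebra -/

section InvariantTheory

variable {σ k : Type*} [Field k]

/-- The chain rule; it turns an algebraic relation among the `f i` into a syzygy among their
derivatives. -/
theorem pderiv_aeval_eq_sum {κ : Type*} [Fintype κ] (f : κ → MvPolynomial σ k)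
    (H : MvPolynomial κ k) (x : σ) :
    pderiv x (aeval f H) = ∑ i, aeval f (pderiv i H) * pderiv x (f i) := by
  classical
  induction H using MvPolynomial.induction_on with
  | C a => simp [algebraMap_eq]
  | add p q hp hq => simp only [map_add, hp, hq, add_mul, Finset.sum_add_distrib]
  | mul_X p j hp =>
    simp only [map_mul, aeval_X, pderiv_mul, hp, map_add, pderiv_X, Finset.sum_mul, add_mul,
      Finset.sum_add_distrib]
    congr 1
    · exact Finset.sum_congr rfl fun i _ => by ring
    · rw [Finset.sum_eq_single j]
      · simp
      · intro i _ hij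
        simp [Pi.single_eq_of_ne hij.symm]
      · simp

theorem pderiv_ne_zero_of_mem_support [CharZero k] {κ : Type*} {H : MvPolynomial κ k}
    {m : κ →₀ ℕ} (hm : m ∈ H.support) {i : κ} (hi : m i ≠ 0) : pderiv i H ≠ 0 := by
  intro h
  have h1 := coeff_pderiv (i := i) H (m - Finsupp.single i 1)
  have hle : Finsupp.single i 1 ≤ m := by
    rw [Finsupp.single_le_iff]; omega
  rw [h, coeff_zero, tsub_add_cancel_of_le hle] at h1
  rcases mul_eq_zero.1 h1.symm with h2 | h2
  · exact mem_support_iff.1 hm h2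
  · exact Nat.cast_add_one_ne_zero _ h2

theorem totalDegree_pderiv_lt {κ : Type*} {H : MvPolynomial κ k} {i : κ}
    (h : pderiv i H ≠ 0) : (pderiv i H).totalDegree < H.totalDegree := by
  obtain ⟨m, hm, hdeg⟩ : ∃ m ∈ (pderiv i H).support, (pderiv i H).totalDegree = m.degree := by
    obtain ⟨m, hm, h2⟩ := Finset.exists_mem_eq_sup _ (support_nonempty.2 h)
      (fun m : κ →₀ ℕ => m.sum fun _ e => e)
    exact ⟨m, hm, h2⟩
  rw [mem_support_iff, coeff_pderiv] at hm
  have h3 := le_totalDegree (mem_support_iff.2 (left_ne_zero_of_mul hm))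
  have h4 : ((m + Finsupp.single i 1).sum fun _ e => e) = m.degree + 1 := by
    change (m + Finsupp.single i 1).degree = _
    rw [map_add, Finsupp.degree_single]
  omega

/-- In characteristic zero vanishing derivatives force `H` to be constant, and a nonzero constant is
not a relation. -/
theorem exists_pderiv_ne_zero [CharZero k] {κ : Type*} {A : Type*} [CommRing A] [Nontrivial A]
    [Algebra k A] {f : κ → A} {H : MvPolynomial κ k} (hH : H ≠ 0) (h : aeval f H = 0) :
    ∃ i, pderiv i H ≠ 0 := by
  by_contra! hall
  have hsupp : ∀ m ∈ H.support, m = 0 := fun m hm => by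
    ext i
    by_contra hi
    exact pderiv_ne_zero_of_mem_support hm hi (hall i)
  have hC : H = C (coeff 0 H) := by
    rw [← totalDegree_eq_zero_iff_eq_C, totalDegree_eq_zero_iff]
    intro m hm i
    rw [hsupp m hm]; rfl
  rw [hC, ← algebraMap_eq, AlgHom.commutes] at h
  have h0 : coeff 0 H = 0 := (algebraMap k A).injective (by rw [h, map_zero])
  rw [h0, C_0] at hC
  exact hH hC

variable {G : Type*} [Group G] [MulSemiringAction G (MvPolynomial σ k)]
  [SMulCommClass G k (MvPolynomial σ k)]

variable (σ k G) in
/-- The span of the products of two invariants without constant term. -/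
def invariantDecomposables : Submodule k (MvPolynomial σ k) :=
  Submodule.span k {z | ∃ x y : MvPolynomial σ k,
    (x ∈ FixedPoints.subalgebra k (MvPolynomial σ k) G ∧ coeff 0 x = 0) ∧
    (y ∈ FixedPoints.subalgebra k (MvPolynomial σ k) G ∧ coeff 0 y = 0) ∧ x * y = z}

/-- Neither factor of a decomposable has a constant term, so both contribute components of degree
strictly between `0` and `n`. -/
theorem homogeneousComponent_mem_of_mem_invariantDecomposables (hG : IsGradedAction σ k G) {n : ℕ}
    {A : Subalgebra k (MvPolynomial σ k)}
    (hA : ∀ m < n, ∀ r : MvPolynomial σ k, r ∈ FixedPoints.subalgebra k (MvPolynomial σ k) G →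
      r.IsHomogeneous m → r ∈ A)
    {x : MvPolynomial σ k} (hx : x ∈ invariantDecomposables σ k G) :
    homogeneousComponent n x ∈ A := by
  refine (Submodule.span_le (p := (Subalgebra.toSubmodule A).comap
    (homogeneousComponent n))).2 ?_ hx
  rintro _ ⟨x, y, hx, hy, rfl⟩
  refine homogeneousComponent_mul_mem (M := (Subalgebra.toSubmodule A).toAddSubmonoid) n x y
    fun i j hij => ?_
  rcases Nat.eq_zero_or_pos i with rfl | hi
  · rw [homogeneousComponent_zero, hx.2, C_0, zero_mul]; exact zero_mem _
  rcases Nat.eq_zero_or_pos j with rfl | hj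
  · rw [homogeneousComponent_zero, hy.2, C_0, mul_zero]; exact zero_mem _
  exact A.mul_mem
    (hA i (by omega) _ (homogeneousComponent_mem_fixedPoints hG i hx.1)
      (homogeneousComponent_isHomogeneous i x))
    (hA j (by omega) _ (homogeneousComponent_mem_fixedPoints hG j hy.1)
      (homogeneousComponent_isHomogeneous j y))

theorem adjoin_eq_fixedPoints (hG : IsGradedAction σ k G) {κ : Type*}
    {f : κ → MvPolynomial σ k} {m : κ → ℕ} (hm : ∀ j, (f j).IsHomogeneous (m j))
    (hf : ∀ j, f j ∈ FixedPoints.subalgebra k (MvPolynomial σ k) G)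
    (hspan : ∀ (n : ℕ) (r : MvPolynomial σ k), r.IsHomogeneous n →
      r ∈ FixedPoints.subalgebra k (MvPolynomial σ k) G → coeff 0 r = 0 →
      ∃ w ∈ Submodule.span k (Set.range f), r - w ∈ invariantDecomposables σ k G) :
    Algebra.adjoin k (Set.range f) = FixedPoints.subalgebra k (MvPolynomial σ k) G := by
  apply le_antisymm
  · rw [Algebra.adjoin_le_iff]
    rintro _ ⟨j, rfl⟩
    exact hf j
  have key : ∀ n : ℕ, ∀ r : MvPolynomial σ k,
      r ∈ FixedPoints.subalgebra k (MvPolynomial σ k) G → r.IsHomogeneous n →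
      r ∈ Algebra.adjoin k (Set.range f) := by
    intro n
    induction n using Nat.strong_induction_on with
    | _ n ih =>
      intro r hr hrn
      rcases Nat.eq_zero_or_pos n with rfl | hn
      · rw [← totalDegree_zero_iff_isHomogeneous, totalDegree_eq_zero_iff_eq_C] at hrn
        rw [hrn, ← algebraMap_eq]
        exact Subalgebra.algebraMap_mem _ _
      · have h0 : coeff 0 r = 0 := hrn.coeff_eq_zero (by simpa using hn.ne)
        obtain ⟨w, hw, hrw⟩ := hspan n r hrn hr h0
        have h1 := homogeneousComponent_mem_of_mem_invariantDecomposables hG ih hrw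
        have h2 := Algebra.span_le_adjoin k _ (homogeneousComponent_mem_span_range hm n hw)
        have h3 := add_mem h1 h2
        rwa [← map_add, sub_add_cancel, homogeneousComponent_eq_self hrn] at h3
  intro r hr
  rw [← sum_homogeneousComponent r]
  exact sum_mem fun i _ => key i _ (homogeneousComponent_mem_fixedPoints hG i hr)
    (homogeneousComponent_isHomogeneous i r)

variable [Fintype G] [CharZero k]

/-- An invariant generator `r` of the ideal comes out of the average, and the remaining average has
no constant term because `s` has none. -/
theorem reynolds_mul_mem_invariantDecomposables (hG : IsGradedAction σ k G)
    {w : MvPolynomial σ k} (hw : w ∈ hilbertIdeal σ k G) {s : MvPolynomial σ k}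
    (hs : coeff 0 s = 0) : reynolds G (s * w) ∈ invariantDecomposables σ k G := by
  induction hw using Submodule.span_induction generalizing s with
  | mem r hr =>
    rw [mul_comm, reynolds_mul hr.1]
    exact Submodule.subset_span ⟨_, _, hr, ⟨reynolds_mem _,
      by rw [coeff_zero_reynolds hG, hs]⟩, rfl⟩
  | zero => simp
  | add x y _ _ hx hy => rw [mul_add, map_add]; exact add_mem (hx hs) (hy hs)
  | smul b x _ hx =>
    rw [smul_eq_mul, ← mul_assoc]
    refine hx ?_
    change constantCoeff (s * b) = 0
    rw [map_mul, show constantCoeff s = 0 from hs, zero_mul]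

/-- Differentiating a relation of least degree gives, for each variable `x`, a syzygy of the `∂f
i/∂x` with coefficients independent of `x`. Chevalley's lemma replaces these by constants `c i`, not
all zero. Euler's identity and averaging then make `∑ c i * m i * f i` decomposable, against `hli`.
-/
theorem algebraicIndependent_of_linearIndependent_mkQ [Fintype σ] (hG : IsGradedAction σ k G)
    (hR : IsGeneratedByReflections σ k G) {κ : Type*} [Fintype κ]
    {f : κ → MvPolynomial σ k} {m : κ → ℕ} (hm : ∀ j, (f j).IsHomogeneous (m j))
    (hf : ∀ j, f j ∈ FixedPoints.subalgebra k (MvPolynomial σ k) G)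
    (hf0 : ∀ j, coeff 0 (f j) = 0)
    (hli : LinearIndependent k fun j => (invariantDecomposables σ k G).mkQ (f j)) :
    AlgebraicIndependent k f := by
  have hm0 : ∀ j, m j ≠ 0 := fun j hj => by
    have h1 := hm j
    rw [hj, ← totalDegree_zero_iff_isHomogeneous, totalDegree_eq_zero_iff_eq_C, hf0 j, C_0] at h1
    exact hli.ne_zero j (by rw [h1, map_zero])
  rw [algebraicIndependent_iff]
  by_contra! hne
  obtain ⟨H, hH, hH0, hmin⟩ : ∃ H : MvPolynomial κ k, aeval f H = 0 ∧ H ≠ 0 ∧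
      ∀ H' : MvPolynomial κ k, H'.totalDegree < H.totalDegree → aeval f H' = 0 → H' = 0 := by
    have hex : ∃ d : ℕ, ∃ H : MvPolynomial κ k, H.totalDegree = d ∧ aeval f H = 0 ∧ H ≠ 0 := by
      obtain ⟨H, h1, h2⟩ := hne
      exact ⟨_, H, rfl, h1, h2⟩
    classical
    obtain ⟨H, h1, h2, h3⟩ := Nat.find_spec hex
    refine ⟨H, h2, h3, fun H' hlt h0 => ?_⟩
    by_contra hH'
    exact Nat.find_min hex (h1 ▸ hlt) ⟨H', rfl, h0, hH'⟩
  obtain ⟨i₀, hi₀⟩ := exists_pderiv_ne_zero hH0 hH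
  -- By minimality of `H` its derivative, of smaller degree, is not a relation.
  have hr₀ : aeval f (pderiv i₀ H) ≠ 0 := fun h =>
    hi₀ (hmin _ (totalDegree_pderiv_lt hi₀) h)
  have hrinv : ∀ i, aeval f (pderiv i H) ∈ FixedPoints.subalgebra k (MvPolynomial σ k) G :=
    fun i => by
      have h1 : aeval f (pderiv i H) ∈ Algebra.adjoin k (Set.range f) := by
        rw [Algebra.adjoin_range_eq_range_aeval]; exact ⟨_, rfl⟩
      refine (Algebra.adjoin_le_iff.2 ?_) h1
      rintro _ ⟨j, rfl⟩
      exact hf j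
  have hex : ∃ d : ℕ, ∃ μ : σ →₀ ℕ, μ.degree = d ∧ ∃ i, coeff μ (aeval f (pderiv i H)) ≠ 0 := by
    obtain ⟨μ, hμ⟩ := ne_zero_iff.1 hr₀
    exact ⟨_, μ, rfl, i₀, hμ⟩
  classical
  obtain ⟨μ, hμd, i₁, hμ⟩ := Nat.find_spec hex
  let c : κ → k := fun i => coeff μ (aeval f (pderiv i H))
  have key : ∀ x : σ, ∑ i, C (c i) * pderiv x (f i) ∈ hilbertIdeal σ k G := fun x =>
    sum_coeff_mul_mem_hilbertIdeal hG hR Finset.univ _ (fun i _ => hrinv i) μ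
      (fun i _ ν hν => by
        by_contra h0
        exact Nat.find_min hex (hμd ▸ hν) ⟨ν, rfl, i, h0⟩) _
      (by rw [← pderiv_aeval_eq_sum, hH, map_zero])
  have heuler : ∑ i, (c i * (m i : k)) • f i = ∑ x, X x * ∑ i, C (c i) * pderiv x (f i) := by
    simp only [Finset.mul_sum]
    rw [Finset.sum_comm]
    refine Finset.sum_congr rfl fun i _ => ?_
    rw [mul_smul, Nat.cast_smul_eq_nsmul, ← (hm i).sum_X_mul_pderiv, Finset.smul_sum]
    refine Finset.sum_congr rfl fun x _ => ?_
    rw [smul_eq_C_mul]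
    ring
  have hmem : ∑ i, (c i * (m i : k)) • f i ∈ invariantDecomposables σ k G := by
    have hinv : ∑ i, (c i * (m i : k)) • f i ∈ FixedPoints.subalgebra k (MvPolynomial σ k) G :=
      sum_mem fun i _ => Subalgebra.smul_mem _ (hf i) _
    rw [← reynolds_eq_self hinv, heuler, map_sum]
    exact sum_mem fun x _ => reynolds_mul_mem_invariantDecomposables hG (key x) (by simp)
  have hz : ∑ i, (c i * (m i : k)) • (invariantDecomposables σ k G).mkQ (f i) = 0 := by
    simp only [← map_smul, ← map_sum]
    exact (Submodule.Quotient.mk_eq_zero _).2 hmem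
  have := Fintype.linearIndependent_iff.1 hli _ hz i₁
  exact (mul_ne_zero hμ (Nat.cast_ne_zero.2 (hm0 i₁))) this

/-- The Chevalley–Shephard–Todd theorem: the invariants of a finite reflection group form a
polynomial algebra. -/
theorem exists_algebraicIndependent_adjoin_eq_fixedPoints [Fintype σ] (hG : IsGradedAction σ k G)
    (hR : IsGeneratedByReflections σ k G) :
    ∃ (f : σ → MvPolynomial σ k) (m : σ → ℕ), (∀ j, (f j).IsHomogeneous (m j)) ∧
      AlgebraicIndependent k f ∧
      Algebra.adjoin k (Set.range f) = FixedPoints.subalgebra k (MvPolynomial σ k) G := by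
  -- Selecting the basis of indecomposables from classes of homogeneous invariants makes its lifts
  -- homogeneous.
  let P := {r : MvPolynomial σ k // (∃ n, r.IsHomogeneous n) ∧
    r ∈ FixedPoints.subalgebra k (MvPolynomial σ k) G ∧ coeff 0 r = 0}
  obtain ⟨κ, a, -, hsp, hli⟩ := exists_linearIndependent' k
    (fun r : P => (invariantDecomposables σ k G).mkQ r.1)
  let f : κ → MvPolynomial σ k := fun j => (a j).1
  choose m hm using fun j => (a j).2.1
  have hind : AlgebraicIndependent k f := by
    -- The family is not yet known to be finite, so independence is tested on finite subfamilies.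
    refine algebraicIndependent_of_finite_type fun t ht => ?_
    have := ht.fintype
    exact algebraicIndependent_of_linearIndependent_mkQ hG hR (m := fun j : t => m j)
      (fun j => hm j) (fun j => (a j).2.2.1) (fun j => (a j).2.2.2)
      (hli.comp ((↑) : t → κ) Subtype.val_injective)
  have hadj : Algebra.adjoin k (Set.range f) = FixedPoints.subalgebra k (MvPolynomial σ k) G := by
    refine adjoin_eq_fixedPoints hG hm (fun j => (a j).2.2.1) fun n r hrn hr hr0 => ?_
    have hmem : (invariantDecomposables σ k G).mkQ r ∈
        (Submodule.span k (Set.range f)).map (invariantDecomposables σ k G).mkQ := by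
      rw [Submodule.map_span, ← Set.range_comp]
      change _ ∈ Submodule.span k
        (Set.range ((fun r : P => (invariantDecomposables σ k G).mkQ r.1) ∘ a))
      rw [hsp]
      exact Submodule.subset_span ⟨⟨r, ⟨n, hrn⟩, hr, hr0⟩, rfl⟩
    obtain ⟨w, hw, hwr⟩ := hmem
    refine ⟨w, hw, (Submodule.Quotient.mk_eq_zero _).1 ?_⟩
    change (invariantDecomposables σ k G).mkQ (r - w) = 0
    rw [map_sub, hwr, sub_self]
  -- Polynomials are integral over the invariants of a finite group, so the generators are as
  -- numerous as the variables.
  have htb : IsTranscendenceBasis k f := by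
    rw [hind.isTranscendenceBasis_iff_isAlgebraic, hadj]
    have hi : Algebra.IsInvariant (FixedPoints.subalgebra k (MvPolynomial σ k) G)
        (MvPolynomial σ k) G := ⟨fun b hb => ⟨⟨b, hb⟩, rfl⟩⟩
    have : Algebra.IsIntegral (FixedPoints.subalgebra k (MvPolynomial σ k) G)
        (MvPolynomial σ k) := Algebra.IsInvariant.isIntegral _ _ G
    exact this.isAlgebraic
  have hcard := htb.lift_cardinalMk_eq (IsTranscendenceBasis.mvPolynomial σ k)
  obtain ⟨e⟩ := Cardinal.lift_mk_eq'.1 hcard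
  refine ⟨f ∘ e.symm, m ∘ e.symm, fun j => hm _, hind.comp _ e.symm.injective, ?_⟩
  rw [Set.range_comp, e.symm.surjective.range_eq, Set.image_univ, hadj]

end InvariantTheory

end MvPolynomial

/-! ### Augmentation, derivatives and linear part on the symmetric algebra -/

section Symmetric

variable {k V : Type*} [Field k] [AddCommGroup V] [Module k V]

namespace SymAlgebra

@[elab_as_elim]
theorem induction {motive : SymAlgebra k V → Prop}
    (algebraMap : ∀ r, motive (algebraMap k (SymAlgebra k V) r))
    (ι : ∀ x, motive (SymAlgebra.ι k V x))
    (mul : ∀ a b, motive a → motive b → motive (a * b))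
    (add : ∀ a b, motive a → motive b → motive (a + b)) (a : SymAlgebra k V) : motive a :=
  SymmetricAlgebra.induction (R := k) (M := V) (motive := motive) algebraMap ι mul add a

variable (k V) in
/-- The augmentation `SV → k`. -/
def augmentation : SymAlgebra k V →ₐ[k] k :=
  SymmetricAlgebra.algebraMapInv.comp (equivSymmetricAlgebra k V).toAlgHom

@[simp]
theorem augmentation_ι (x : V) : augmentation k V (ι k V x) = 0 :=
  SymmetricAlgebra.algebraMapInv_ι x

end SymAlgebra

section PartialDerivatives

variable {κ : Type*} (e : Module.Basis κ k V)

theorem symEquivMvPolynomial_ι (a : κ) :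
    symEquivMvPolynomial e (SymAlgebra.ι k V (e a)) = MvPolynomial.X a :=
  SymmetricAlgebra.equivMvPolynomial_ι_apply e a

/-- The partial derivative as a linear map. -/
def partialDLinear (a : κ) : SymAlgebra k V →ₗ[k] SymAlgebra k V :=
  (symEquivMvPolynomial e).symm.toLinearMap ∘ₗ (MvPolynomial.pderiv a).toLinearMap ∘ₗ
    (symEquivMvPolynomial e).toLinearMap

theorem partialDLinear_apply (a : κ) (f : SymAlgebra k V) :
    partialDLinear e a f = partialD e a f := rfl

theorem partialD_mul (a : κ) (f g : SymAlgebra k V) :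
    partialD e a (f * g) = partialD e a f * g + f * partialD e a g := by
  simp only [partialD, MvPolynomial.pderiv_mul, map_add, map_mul, AlgEquiv.symm_apply_apply]

theorem partialD_algebraMap (a : κ) (r : k) :
    partialD e a (algebraMap k (SymAlgebra k V) r) = 0 := by
  simp [partialD, MvPolynomial.algebraMap_eq]

theorem partialD_ι (a : κ) (x : V) :
    partialD e a (SymAlgebra.ι k V x) = algebraMap k (SymAlgebra k V) (e.coord a x) := by
  classical
  suffices h : partialDLinear e a ∘ₗ SymAlgebra.ι k V =
      Algebra.linearMap k (SymAlgebra k V) ∘ₗ e.coord a from LinearMap.congr_fun h x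
  refine e.ext fun b => ?_
  simp only [LinearMap.comp_apply, partialDLinear_apply, partialD, symEquivMvPolynomial_ι,
    Algebra.linearMap_apply, Module.Basis.coord_apply, Module.Basis.repr_self,
    MvPolynomial.pderiv_X, Finsupp.single_apply, Pi.single_apply]
  by_cases h : a = b
  · subst h; simp
  · rw [if_neg (Ne.symm h)]; simp [Ne.symm h]

variable [Fintype κ]

/-- The linear part `∑ₐ (∂f/∂e_a)(0) e_a ∈ V` of `f ∈ SV`. -/
def linearPart : SymAlgebra k V →ₗ[k] V :=
  ∑ a, ((SymAlgebra.augmentation k V).toLinearMap ∘ₗ partialDLinear e a).smulRight (e a)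

theorem linearPart_apply (f : SymAlgebra k V) :
    linearPart e f = ∑ a, SymAlgebra.augmentation k V (partialD e a f) • e a := by
  simp [linearPart, LinearMap.sum_apply, partialDLinear_apply]

theorem linearPart_mul (f g : SymAlgebra k V) :
    linearPart e (f * g) = SymAlgebra.augmentation k V f • linearPart e g +
      SymAlgebra.augmentation k V g • linearPart e f := by
  simp only [linearPart_apply, partialD_mul, map_add, map_mul, add_smul, Finset.sum_add_distrib,
    Finset.smul_sum, smul_smul]
  rw [add_comm]
  congr 1
  exact Finset.sum_congr rfl fun a _ => by rw [mul_comm]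

theorem linearPart_ι (x : V) : linearPart e (SymAlgebra.ι k V x) = x := by
  simp [linearPart_apply, partialD_ι, e.sum_repr]

theorem linearPart_algebraMap (r : k) :
    linearPart e (algebraMap k (SymAlgebra k V) r) = 0 := by
  simp [linearPart_apply, partialD_algebraMap]

/-- The linear part is determined by being a derivation along the augmentation that is the identity
on `V`. -/
theorem linearPart_eq {κ' : Type*} [Fintype κ'] (e' : Module.Basis κ' k V)
    (f : SymAlgebra k V) : linearPart e f = linearPart e' f := by
  induction f using SymAlgebra.induction with
  | algebraMap r => rw [linearPart_algebraMap, linearPart_algebraMap]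
  | ι x => rw [linearPart_ι, linearPart_ι]
  | mul f g hf hg => rw [linearPart_mul, linearPart_mul, hf, hg]
  | add f g hf hg => rw [map_add, map_add, hf, hg]

end PartialDerivatives

end Symmetric

/-! ### Acyclicity of the Koszul algebra -/

section Acyclicity

open CliffordAlgebra

variable {k V : Type*} [Field k] [AddCommGroup V] [Module k V]

/-- The algebra map `SV ⊗ Cl(V, Q) → Cl(V, Q)` induced by the augmentation of `SV`. -/
def koszulAug (Q : QuadraticForm k V) : KoszulAlgebra Q →ₐ[k] CliffordAlgebra Q :=
  Algebra.TensorProduct.lift ((Algebra.ofId k _).comp (SymAlgebra.augmentation k V))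
    (AlgHom.id k _) fun f c =>
      Algebra.commutes (SymAlgebra.augmentation k V f) c

theorem koszulAug_tmul (Q : QuadraticForm k V) (f : SymAlgebra k V) (c : CliffordAlgebra Q) :
    koszulAug Q (f ⊗ₜ c) = SymAlgebra.augmentation k V f • c := by
  rw [Algebra.smul_def]
  exact Algebra.TensorProduct.lift_tmul _ _ _ f c

variable [FiniteDimensional k V]

theorem koszulAug_koszulParity (Q : QuadraticForm k V) (z : KoszulAlgebra Q) :
    koszulAug Q (koszulParity Q z) = involute (koszulAug Q z) := by
  induction z using TensorProduct.induction_on with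
  | zero => simp
  | add x y hx hy => simp only [map_add, hx, hy]
  | tmul f c => rw [koszulParity_tmul, koszulAug_tmul, koszulAug_tmul, map_smul]

/-- Every term of the differential has a factor from `V` in `SV`. Consequently `koszulAug` depends
only on cohomology classes. -/
theorem koszulAug_koszulD (Q : QuadraticForm k V) (z : KoszulAlgebra Q) :
    koszulAug Q (koszulD Q z) = 0 := by
  induction z using TensorProduct.induction_on with
  | zero => simp
  | add x y hx hy => rw [map_add, map_add, hx, hy, add_zero]
  | tmul f c => simp [koszulD_tmul, koszulAug_tmul]

variable (k V) in
/-- The contracting homotopy `f ⊗ c ↦ ∑ₐ ∂f/∂e_a ⊗ e_a ∧ c` of the Koszul complex. -/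
def koszulHomotopy : KoszulAlgebra (0 : QuadraticForm k V) →ₗ[k]
    KoszulAlgebra (0 : QuadraticForm k V) :=
  ∑ a, TensorProduct.map (partialDLinear (Module.finBasis k V) a)
    (LinearMap.mulLeft k (ι (0 : QuadraticForm k V) (Module.finBasis k V a)))

theorem koszulHomotopy_tmul (f : SymAlgebra k V) (c : CliffordAlgebra (0 : QuadraticForm k V)) :
    koszulHomotopy k V (f ⊗ₜ c) = ∑ a, partialD (Module.finBasis k V) a f ⊗ₜ
      (ι (0 : QuadraticForm k V) (Module.finBasis k V a) * c) := by
  simp [koszulHomotopy, LinearMap.sum_apply, partialDLinear_apply]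

variable (k V) in
/-- The Euler operator of the symmetric algebra. -/
def symEuler : SymAlgebra k V →ₗ[k] SymAlgebra k V :=
  ∑ a, LinearMap.mulLeft k (SymAlgebra.ι k V (Module.finBasis k V a)) ∘ₗ
    partialDLinear (Module.finBasis k V) a

variable (k V) in
/-- The Euler operator of the exterior algebra. -/
def extEuler : CliffordAlgebra (0 : QuadraticForm k V) →ₗ[k]
    CliffordAlgebra (0 : QuadraticForm k V) :=
  ∑ a, LinearMap.mulLeft k (ι (0 : QuadraticForm k V) (Module.finBasis k V a)) ∘ₗ
    contractLeft ((Module.finBasis k V).coord a)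

theorem symEuler_apply (f : SymAlgebra k V) :
    symEuler k V f = ∑ a, SymAlgebra.ι k V (Module.finBasis k V a) *
      partialD (Module.finBasis k V) a f := by
  simp [symEuler, LinearMap.sum_apply, partialDLinear_apply]

theorem extEuler_apply (c : CliffordAlgebra (0 : QuadraticForm k V)) :
    extEuler k V c = ∑ a, ι (0 : QuadraticForm k V) (Module.finBasis k V a) *
      contractLeft ((Module.finBasis k V).coord a) c := by
  simp [extEuler, LinearMap.sum_apply]

theorem symEuler_ι (x : V) : symEuler k V (SymAlgebra.ι k V x) = SymAlgebra.ι k V x := by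
  rw [symEuler_apply]
  simp only [partialD_ι, mul_comm _ (algebraMap k (SymAlgebra k V) _), ← Algebra.smul_def,
    ← map_smul, ← map_sum, Module.Basis.coord_apply, Module.Basis.sum_repr]

theorem symEuler_mul (f g : SymAlgebra k V) :
    symEuler k V (f * g) = symEuler k V f * g + f * symEuler k V g := by
  simp only [symEuler_apply, partialD_mul, Finset.sum_mul, Finset.mul_sum,
    ← Finset.sum_add_distrib]
  exact Finset.sum_congr rfl fun a _ => by ring

theorem symEuler_algebraMap (r : k) :
    symEuler k V (algebraMap k (SymAlgebra k V) r) = 0 := by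
  simp [symEuler_apply, partialD_algebraMap]

theorem extEuler_algebraMap (r : k) :
    extEuler k V (algebraMap k _ r) = 0 := by
  simp [extEuler_apply, contractLeft_algebraMap]

/-- The sign from contracting past `x` cancels the sign from anticommuting `x` with basis vectors,
which is available because the form is zero. -/
theorem extEuler_ι_mul (x : V) (c : CliffordAlgebra (0 : QuadraticForm k V)) :
    extEuler k V (ι _ x * c) = ι _ x * c + ι _ x * extEuler k V c := by
  have h : ∀ a, ι (0 : QuadraticForm k V) (Module.finBasis k V a) *
      contractLeft ((Module.finBasis k V).coord a) (ι (0 : QuadraticForm k V) x * c) =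
      ι (0 : QuadraticForm k V) ((Module.finBasis k V).repr x a • Module.finBasis k V a) * c +
      ι (0 : QuadraticForm k V) x * (ι (0 : QuadraticForm k V) (Module.finBasis k V a) *
        contractLeft ((Module.finBasis k V).coord a) c) := fun a => by
    have hanti : ι (0 : QuadraticForm k V) x * ι (0 : QuadraticForm k V) (Module.finBasis k V a) =
        -(ι (0 : QuadraticForm k V) (Module.finBasis k V a) * ι (0 : QuadraticForm k V) x) := by
      rw [eq_neg_iff_add_eq_zero, ι_mul_ι_add_swap]
      simp [QuadraticMap.polar]
    rw [contractLeft_ι_mul, ← mul_assoc (ι (0 : QuadraticForm k V) x), hanti]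
    simp only [mul_sub, Module.Basis.coord_apply, map_smul, smul_mul_assoc, mul_smul_comm, neg_mul,
      mul_assoc]
    rw [sub_eq_add_neg]
  rw [extEuler_apply, Finset.sum_congr rfl fun a _ => h a, Finset.sum_add_distrib,
    ← Finset.sum_mul, ← map_sum, Module.Basis.sum_repr, ← Finset.mul_sum, extEuler_apply]

/-- Cartan's formula: in the double sum over pairs of basis vectors the off-diagonal terms cancel,
and the diagonal ones leave the two Euler operators. -/
theorem koszulHomotopy_formula (f : SymAlgebra k V)
    (c : CliffordAlgebra (0 : QuadraticForm k V)) :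
    koszulD 0 (koszulHomotopy k V (f ⊗ₜ c)) + koszulHomotopy k V (koszulD 0 (f ⊗ₜ c)) =
      symEuler k V f ⊗ₜ c + f ⊗ₜ extEuler k V c := by
  classical
  have h1 : ∀ a b, (SymAlgebra.ι k V (Module.finBasis k V b) *
        partialD (Module.finBasis k V) a f) ⊗ₜ[k]
        contractLeft ((Module.finBasis k V).coord b)
          (ι (0 : QuadraticForm k V) (Module.finBasis k V a) * c) +
      partialD (Module.finBasis k V) a (SymAlgebra.ι k V (Module.finBasis k V b) * f) ⊗ₜ[k]
        (ι (0 : QuadraticForm k V) (Module.finBasis k V a) *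
          contractLeft ((Module.finBasis k V).coord b) c) =
      if b = a then (SymAlgebra.ι k V (Module.finBasis k V b) *
        partialD (Module.finBasis k V) a f) ⊗ₜ[k] c +
        f ⊗ₜ[k] (ι (0 : QuadraticForm k V) (Module.finBasis k V a) *
          contractLeft ((Module.finBasis k V).coord b) c) else 0 := fun a b => by
    rw [contractLeft_ι_mul, partialD_mul, partialD_ι, TensorProduct.tmul_sub,
      TensorProduct.add_tmul]
    simp only [Module.Basis.coord_apply, Module.Basis.repr_self, Finsupp.single_apply]
    by_cases hab : b = a
    · subst hab; simp only [if_true, one_smul, map_one, one_mul]; abel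
    · rw [if_neg hab, if_neg hab, if_neg (Ne.symm hab)]; simp
  simp only [koszulHomotopy_tmul, koszulD_tmul, map_sum, symEuler_apply, extEuler_apply,
    TensorProduct.sum_tmul, TensorProduct.tmul_sum]
  rw [Finset.sum_comm (s := Finset.univ (α := Fin (Module.finrank k V))) (t := Finset.univ)
    (f := fun b a => partialD (Module.finBasis k V) a
      (SymAlgebra.ι k V (Module.finBasis k V b) * f) ⊗ₜ[k]
        (ι (0 : QuadraticForm k V) (Module.finBasis k V a) *
          contractLeft ((Module.finBasis k V).coord b) c)), ← Finset.sum_add_distrib,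
    ← Finset.sum_add_distrib]
  refine Finset.sum_congr rfl fun a _ => ?_
  rw [← Finset.sum_add_distrib, Finset.sum_congr rfl fun b _ => h1 a b]
  simp

variable (k V) in
/-- The total degree operator of `SV ⊗ ⋀V`. -/
def koszulEuler : KoszulAlgebra (0 : QuadraticForm k V) →ₗ[k]
    KoszulAlgebra (0 : QuadraticForm k V) :=
  koszulD 0 ∘ₗ koszulHomotopy k V + koszulHomotopy k V ∘ₗ koszulD 0

theorem koszulEuler_apply (z : KoszulAlgebra (0 : QuadraticForm k V)) :
    koszulEuler k V z =
      koszulD 0 (koszulHomotopy k V z) + koszulHomotopy k V (koszulD 0 z) := rfl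

variable (k V) in
/-- The elements that the operators `koszulEuler - i`, `1 ≤ i ≤ n`, together map to scalars. -/
def koszulFiltration : ℕ → Submodule k (KoszulAlgebra (0 : QuadraticForm k V))
  | 0 => Submodule.span k {1}
  | n + 1 => (koszulFiltration n).comap (koszulEuler k V - ((n + 1 : ℕ) : k) • LinearMap.id)

theorem mem_koszulFiltration_succ {n : ℕ} {z : KoszulAlgebra (0 : QuadraticForm k V)} :
    z ∈ koszulFiltration k V (n + 1) ↔
      koszulEuler k V z - ((n + 1 : ℕ) : k) • z ∈ koszulFiltration k V n := Iff.rfl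

theorem koszulFiltration_mono : Monotone (koszulFiltration k V) := by
  refine monotone_nat_of_le_succ fun n => ?_
  induction n with
  | zero =>
    change Submodule.span k {1} ≤ _
    rw [Submodule.span_singleton_le_iff_mem, mem_koszulFiltration_succ]
    have h1 : koszulEuler k V 1 = 0 := by
      have h2 := koszulHomotopy_formula (k := k) (V := V) 1 1
      rw [← koszulEuler_apply, ← map_one (algebraMap k (SymAlgebra k V)), symEuler_algebraMap,
        ← map_one (algebraMap k (CliffordAlgebra (0 : QuadraticForm k V))), extEuler_algebraMap,
        map_one, map_one, TensorProduct.zero_tmul, TensorProduct.tmul_zero, add_zero] at h2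
      exact h2
    rw [h1, zero_sub]
    exact neg_mem (Submodule.smul_mem _ _ (Submodule.subset_span rfl))
  | succ n ih =>
    intro z hz
    rw [mem_koszulFiltration_succ]
    have h1 := ih (mem_koszulFiltration_succ.1 hz)
    have h2 := sub_mem h1 hz
    have : koszulEuler k V z - ((n + 1 + 1 : ℕ) : k) • z =
        koszulEuler k V z - ((n + 1 : ℕ) : k) • z - z := by
      push_cast
      module
    rwa [this]

/-- Both tensor factors are spanned by eigenvectors of their Euler operators with natural
eigenvalues, where those chosen for eigenvalue `0` are scalars. A tensor of total eigenvalue `n + 1`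
is killed by the last operator in step `n + 1` of the filtration. -/
theorem tmul_mem_span_koszulFiltration (f : SymAlgebra k V)
    (c : CliffordAlgebra (0 : QuadraticForm k V)) :
    f ⊗ₜ c ∈ Submodule.span k {z | ∃ n : ℕ, z ∈ koszulFiltration k V n} := by
  have hsym : f ∈ Submodule.span k {f | ∃ p : ℕ, symEuler k V f = (p : k) • f ∧
      (p = 0 → ∃ r, f = algebraMap k _ r)} := by
    induction f using SymAlgebra.induction with
    | algebraMap r =>
      exact Submodule.subset_span ⟨0, by simp [symEuler_algebraMap], fun _ => ⟨r, rfl⟩⟩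
    | ι x => exact Submodule.subset_span ⟨1, by simp [symEuler_ι], by simp⟩
    | add f g hf hg => exact add_mem hf hg
    | mul f g hf hg =>
      have := Submodule.mul_mem_mul hf hg
      rw [Submodule.span_mul_span] at this
      refine Submodule.span_mono ?_ this
      rintro _ ⟨x, ⟨p, hp, hp0⟩, y, ⟨q, hq, hq0⟩, rfl⟩
      refine ⟨p + q, ?_, fun h => ?_⟩
      · change symEuler k V (x * y) = _ • (x * y)
        rw [symEuler_mul, hp, hq, Nat.cast_add, add_smul, smul_mul_assoc, mul_smul_comm]
      · obtain ⟨r, rfl⟩ := hp0 (by omega)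
        obtain ⟨s, rfl⟩ := hq0 (by omega)
        exact ⟨r * s, (map_mul _ _ _).symm⟩
  have hext : c ∈ Submodule.span k {c | ∃ q : ℕ, extEuler k V c = (q : k) • c ∧
      (q = 0 → ∃ r, c = algebraMap k _ r)} := by
    induction c using CliffordAlgebra.left_induction with
    | algebraMap r =>
      exact Submodule.subset_span ⟨0, by simp [extEuler_algebraMap], fun _ => ⟨r, rfl⟩⟩
    | add a b ha hb => exact add_mem ha hb
    | ι_mul c x hc =>
      refine (Submodule.span_le (p := (Submodule.span k _).comap
        (LinearMap.mulLeft k (ι (0 : QuadraticForm k V) x)))).2 ?_ hc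
      rintro c ⟨q, hq, -⟩
      refine Submodule.subset_span ⟨q + 1, ?_, by simp⟩
      rw [LinearMap.mulLeft_apply, extEuler_ι_mul, hq, Nat.cast_succ, add_smul, one_smul,
        mul_smul_comm, add_comm]
  have h := Submodule.apply_mem_map₂ (TensorProduct.mk k _ _) hsym hext
  rw [Submodule.map₂_span_span] at h
  refine Submodule.span_mono ?_ h
  rintro _ ⟨x, ⟨p, hp, hp0⟩, y, ⟨q, hq, hq0⟩, rfl⟩
  have he : koszulEuler k V (x ⊗ₜ y) = ((p + q : ℕ) : k) • (x ⊗ₜ y) := by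
    rw [koszulEuler_apply, koszulHomotopy_formula, hp, hq, Nat.cast_add, add_smul,
      TensorProduct.smul_tmul', TensorProduct.tmul_smul]
  refine ⟨p + q, ?_⟩
  rcases hpq : p + q with _ | n
  · obtain ⟨r, rfl⟩ := hp0 (by omega)
    obtain ⟨s, rfl⟩ := hq0 (by omega)
    refine Submodule.mem_span_singleton.2 ⟨r * s, ?_⟩
    change _ = algebraMap k _ r ⊗ₜ[k] algebraMap k _ s
    rw [Algebra.algebraMap_eq_smul_one, Algebra.algebraMap_eq_smul_one,
      TensorProduct.smul_tmul_smul, Algebra.TensorProduct.one_def]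
  · change x ⊗ₜ[k] y ∈ _
    rw [mem_koszulFiltration_succ, he, hpq, sub_self]
    exact zero_mem _

theorem exists_mem_koszulFiltration (z : KoszulAlgebra (0 : QuadraticForm k V)) :
    ∃ n, z ∈ koszulFiltration k V n := by
  have hz : z ∈ Submodule.span k {z | ∃ n : ℕ, z ∈ koszulFiltration k V n} := by
    induction z using TensorProduct.induction_on with
    | zero => exact zero_mem _
    | add x y hx hy => exact add_mem hx hy
    | tmul f c => exact tmul_mem_span_koszulFiltration f c
  induction hz using Submodule.span_induction with
  | mem x hx => exact hx
  | zero => exact ⟨0, zero_mem _⟩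
  | add x y _ _ hx hy =>
    obtain ⟨m, hm⟩ := hx
    obtain ⟨n, hn⟩ := hy
    exact ⟨max m n, add_mem (koszulFiltration_mono (le_max_left m n) hm)
      (koszulFiltration_mono (le_max_right m n) hn)⟩
  | smul r x _ hx =>
    obtain ⟨n, hn⟩ := hx
    exact ⟨n, Submodule.smul_mem _ r hn⟩

variable [CharZero k]

/-- On a cocycle the degree operator is the coboundary of the homotopy. Subtracting `(n + 1) • z`
leaves a cocycle one step lower in the filtration, and the resulting identity is solved for `z` by
dividing by `n + 1`. -/
theorem exists_eq_add_koszulD_zero {z : KoszulAlgebra (0 : QuadraticForm k V)}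
    (hz : koszulD 0 z = 0) :
    ∃ (r : k) (y : KoszulAlgebra (0 : QuadraticForm k V)),
      z = algebraMap k _ r + koszulD 0 y := by
  obtain ⟨n, hn⟩ := exists_mem_koszulFiltration z
  induction n generalizing z with
  | zero =>
    obtain ⟨r, rfl⟩ := Submodule.mem_span_singleton.1 hn
    exact ⟨r, 0, by rw [map_zero, add_zero, Algebra.algebraMap_eq_smul_one]⟩
  | succ n ih =>
    have hE : koszulEuler k V z = koszulD 0 (koszulHomotopy k V z) := by
      rw [koszulEuler_apply, hz, map_zero, add_zero]
    obtain ⟨r, y, hy⟩ := ih (z := koszulEuler k V z - ((n + 1 : ℕ) : k) • z)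
      (by rw [map_sub, map_smul, hz, hE, koszulD_koszulD, smul_zero, sub_zero])
      (mem_koszulFiltration_succ.1 hn)
    have hn0 : ((n + 1 : ℕ) : k) ≠ 0 := Nat.cast_ne_zero.2 (Nat.succ_ne_zero n)
    refine ⟨-(((n + 1 : ℕ) : k)⁻¹ * r),
      ((n + 1 : ℕ) : k)⁻¹ • (koszulHomotopy k V z - y), ?_⟩
    rw [hE] at hy
    have h1 : ((n + 1 : ℕ) : k) • z =
        koszulD 0 (koszulHomotopy k V z) - (algebraMap k _ r + koszulD 0 y) := by
      rw [← hy, sub_sub_cancel]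
    rw [← eq_inv_smul_iff₀ hn0] at h1
    rw [map_smul, map_sub, map_neg, map_mul, ← Algebra.smul_def, smul_sub]
    refine h1.trans ?_
    rw [smul_sub, smul_add]
    abel

/-- The Koszul complex of any quadratic form is acyclic. -/
theorem exists_eq_add_koszulD (Q : QuadraticForm k V) {z : KoszulAlgebra Q}
    (hz : koszulD Q z = 0) :
    ∃ (r : k) (y : KoszulAlgebra Q), z = algebraMap k _ r + koszulD Q y := by
  have : Invertible (2 : k) := invertibleOfNonzero two_ne_zero
  -- The change of form is linear only, but it commutes with contractions and hence with the
  -- differential, which is enough for a statement about cocycles.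
  let T := TensorProduct.congr (LinearEquiv.refl k (SymAlgebra k V))
    (changeFormEquiv (Q := Q) (Q' := 0) (B := QuadraticMap.associated (R := k) (-Q))
      changeForm.associated_neg_proof)
  have hT : ∀ z, T (koszulD Q z) = koszulD 0 (T z) := fun z => by
    induction z using TensorProduct.induction_on with
    | zero => simp
    | add x y hx hy => simp only [map_add, hx, hy]
    | tmul f c =>
      simp only [koszulD_tmul, map_sum, T, TensorProduct.congr_tmul, LinearEquiv.refl_apply,
        changeFormEquiv_apply, changeForm_contractLeft]
  have hT1 : ∀ r : k, T (algebraMap k _ r) = algebraMap k _ r := fun r => by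
    simp only [Algebra.algebraMap_eq_smul_one, map_smul, Algebra.TensorProduct.one_def, T,
      TensorProduct.congr_tmul, LinearEquiv.refl_apply, changeFormEquiv_apply, changeForm_one]
  obtain ⟨r, y, h⟩ := exists_eq_add_koszulD_zero (z := T z) (by rw [← hT, hz, map_zero])
  refine ⟨r, T.symm y, T.injective ?_⟩
  rw [map_add, hT1, hT, LinearEquiv.apply_symm_apply, h]

theorem algebraMap_cohomology_bijective (Q : QuadraticForm k V) :
    Function.Bijective (algebraMap k (koszul Q).Cohomology) := by
  have : Invertible (2 : k) := invertibleOfNonzero two_ne_zero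
  constructor
  · rw [injective_iff_map_eq_zero]
    intro r hr
    obtain ⟨y, hy⟩ : (algebraMap k (koszul Q).cocycles r) ∈ (koszul Q).coboundaries :=
      Ideal.Quotient.eq_zero_iff_mem.1 hr
    have h1 := koszulAug_koszulD Q y
    have h2 : koszulD Q y = algebraMap k _ r := hy
    rw [h2, AlgHom.commutes] at h1
    exact (algebraMap k (CliffordAlgebra Q)).injective (by rw [h1, map_zero])
  · intro c
    obtain ⟨⟨z, hz⟩, rfl⟩ := Ideal.Quotient.mk_surjective c
    obtain ⟨r, y, h⟩ := exists_eq_add_koszulD Q (z := z) hz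
    refine ⟨r, ?_⟩
    change Ideal.Quotient.mk _ (algebraMap k (koszul Q).cocycles r) = _
    rw [eq_comm, Ideal.Quotient.eq]
    exact ⟨y, by rw [eq_comm]; exact sub_eq_iff_eq_add'.2 h⟩

/-- A cocycle is a scalar plus a coboundary, and the augmentation kills the coboundary. -/
theorem hasScalarClass_iff (Q : QuadraticForm k V) {z : KoszulAlgebra Q} {r : k} :
    HasScalarClass Q z r ↔ koszulD Q z = 0 ∧ koszulAug Q z = algebraMap k _ r := by
  have : Invertible (2 : k) := invertibleOfNonzero two_ne_zero
  have key : ∀ h : koszulD Q z = 0, ((koszul Q).cls z h = algebraMap k _ r ↔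
      ∃ y, koszulD Q y = z - algebraMap k _ r) := fun h =>
    Ideal.Quotient.eq (I := (koszul Q).coboundaries) (x := ⟨z, h⟩)
      (y := algebraMap k (koszul Q).cocycles r)
  constructor
  · rintro ⟨h, h'⟩
    obtain ⟨y, hy⟩ := (key h).1 h'
    refine ⟨h, ?_⟩
    have h1 := koszulAug_koszulD Q y
    rw [hy, map_sub, AlgHom.commutes] at h1
    exact sub_eq_zero.1 h1
  · rintro ⟨h, h'⟩
    refine ⟨h, (key h).2 ?_⟩
    obtain ⟨s, y, hy⟩ := exists_eq_add_koszulD Q h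
    have h1 : algebraMap k (CliffordAlgebra Q) s = algebraMap k _ r := by
      rw [← h', hy, map_add, koszulAug_koszulD, add_zero, AlgHom.commutes]
    rw [← (algebraMap k (CliffordAlgebra Q)).injective h1]
    exact ⟨y, by rw [hy, add_sub_cancel_left]⟩

end Acyclicity

/-! ### Ordered products in a Clifford algebra, paired with cochains -/

section OrderedProducts

variable {k U A : Type*} [CommRing k] [Ring U] [Algebra k U] [Ring A] [Algebra k A]

/-- The span of the ordered products of the pairs `(v j, C j)`, `j < i`, in `U × A`. -/
def orderedProductSpan (v : ℕ → U) (C : ℕ → A) : ℕ → Submodule k (U × A)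
  | 0 => Submodule.span k {1}
  | i + 1 => orderedProductSpan v C i ⊔
      (orderedProductSpan v C i).map (LinearMap.mulLeft k (v i, C i))

variable {v : ℕ → U} {C : ℕ → A}

theorem mem_orderedProductSpan_zero {z : U × A} :
    z ∈ orderedProductSpan (k := k) v C 0 ↔ ∃ r : k, r • 1 = z :=
  Submodule.mem_span_singleton

theorem mem_orderedProductSpan_succ {i : ℕ} {z : U × A} :
    z ∈ orderedProductSpan (k := k) v C (i + 1) ↔
      ∃ x ∈ orderedProductSpan (k := k) v C i, ∃ y ∈ orderedProductSpan (k := k) v C i,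
        x + (v i, C i) * y = z := by
  rw [orderedProductSpan, Submodule.mem_sup]
  constructor
  · rintro ⟨x, hx, _, ⟨y, hy, rfl⟩, rfl⟩
    exact ⟨x, hx, y, hy, rfl⟩
  · rintro ⟨x, hx, y, hy, rfl⟩
    exact ⟨x, hx, _, ⟨y, hy, rfl⟩, rfl⟩

theorem orderedProductSpan_le_succ (i : ℕ) :
    orderedProductSpan (k := k) v C i ≤ orderedProductSpan v C (i + 1) := le_sup_left

theorem one_mem_orderedProductSpan (i : ℕ) : (1 : U × A) ∈ orderedProductSpan (k := k) v C i := by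
  induction i with
  | zero => exact Submodule.subset_span rfl
  | succ i ih => exact orderedProductSpan_le_succ i ih

theorem mul_mem_orderedProductSpan_succ {i : ℕ} {y : U × A}
    (hy : y ∈ orderedProductSpan (k := k) v C i) :
    (v i, C i) * y ∈ orderedProductSpan (k := k) v C (i + 1) :=
  mem_orderedProductSpan_succ.2 ⟨0, zero_mem _, y, hy, zero_add _⟩

end OrderedProducts

section CliffordOrderedProducts

variable {k M A : Type*} [CommRing k] [AddCommGroup M] [Module k M] [Ring A] [Algebra k A]
  {q : QuadraticForm k M} {w : ℕ → M} {C : ℕ → A}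

/-- Only the Clifford component is prescribed. It is reordered by the Clifford relations, and the
companion `t` in `A` is whatever the same ordered expression gives there, so no relations among the
`C j` are needed. -/
theorem exists_ι_mul_mem_orderedProductSpan {i j : ℕ} (hj : j < i)
    {x : CliffordAlgebra q × A}
    (hx : x ∈ orderedProductSpan (k := k) (fun j => CliffordAlgebra.ι q (w j)) C i) :
    ∃ t, (CliffordAlgebra.ι q (w j) * x.1, t) ∈
      orderedProductSpan (k := k) (fun j => CliffordAlgebra.ι q (w j)) C i := by
  induction i generalizing j x with
  | zero => omega
  | succ i ih =>
    obtain ⟨x₁, hx₁, x₂, hx₂, rfl⟩ := mem_orderedProductSpan_succ.1 hx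
    rcases Nat.lt_succ_iff_lt_or_eq.1 hj with hji | rfl
    · obtain ⟨t₁, ht₁⟩ := ih hji hx₁
      obtain ⟨t₂, ht₂⟩ := ih hji hx₂
      have h1 := orderedProductSpan_le_succ i ht₁
      have h2 := mul_mem_orderedProductSpan_succ (neg_mem ht₂)
      have h3 := orderedProductSpan_le_succ i (Submodule.smul_mem _
        (QuadraticMap.polar q (w j) (w i)) hx₂)
      refine ⟨t₁ + C i * -t₂ + QuadraticMap.polar q (w j) (w i) • x₂.2, ?_⟩
      · convert add_mem (add_mem h1 h2) h3 using 1
        refine Prod.ext ?_ rfl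
        have hs := CliffordAlgebra.ι_mul_ι_add_swap (Q := q) (w j) (w i)
        have hs' : CliffordAlgebra.ι q (w j) * CliffordAlgebra.ι q (w i) =
            algebraMap k _ (QuadraticMap.polar q (w j) (w i)) -
              CliffordAlgebra.ι q (w i) * CliffordAlgebra.ι q (w j) := by
          rw [← hs, add_sub_cancel_right]
        simp only [Prod.fst_add, Prod.fst_mul, Prod.smul_fst, Prod.fst_neg, mul_add]
        rw [← mul_assoc (CliffordAlgebra.ι q (w j)), hs', sub_mul, ← Algebra.smul_def, mul_assoc]
        simp only [mul_neg]
        abel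
    · have h1 := mul_mem_orderedProductSpan_succ hx₁
      have h2 := orderedProductSpan_le_succ j (Submodule.smul_mem _ (q (w j)) hx₂)
      refine ⟨C j * x₁.2 + q (w j) • x₂.2, ?_⟩
      · convert add_mem h1 h2 using 1
        refine Prod.ext ?_ rfl
        simp only [Prod.fst_add, Prod.fst_mul, Prod.smul_fst, mul_add]
        rw [← mul_assoc, CliffordAlgebra.ι_sq_scalar, ← Algebra.smul_def]

theorem exists_mem_orderedProductSpan {n : ℕ} (hw : Submodule.span k (w '' {j | j < n}) = ⊤)
    (u : CliffordAlgebra q) :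
    ∃ t, (u, t) ∈ orderedProductSpan (k := k) (fun j => CliffordAlgebra.ι q (w j)) C n := by
  induction u using CliffordAlgebra.left_induction with
  | algebraMap r =>
    refine ⟨r • 1, ?_⟩
    rw [Algebra.algebraMap_eq_smul_one]
    exact Submodule.smul_mem _ r (one_mem_orderedProductSpan n)
  | add x y hx hy =>
    obtain ⟨s, hs⟩ := hx
    obtain ⟨t, ht⟩ := hy
    exact ⟨s + t, add_mem hs ht⟩
  | ι_mul x m hx =>
    obtain ⟨s, hs⟩ := hx
    have hm : m ∈ Submodule.span k (w '' {j | j < n}) := by rw [hw]; trivial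
    induction hm using Submodule.span_induction with
    | mem _ h =>
      obtain ⟨j, hj, rfl⟩ := h
      exact exists_ι_mul_mem_orderedProductSpan hj hs
    | zero => exact ⟨0, by rw [map_zero, zero_mul]; exact zero_mem _⟩
    | add a b _ _ ha hb =>
      obtain ⟨t, ht⟩ := ha
      obtain ⟨t', ht'⟩ := hb
      exact ⟨t + t', by rw [map_add, add_mul]; exact add_mem ht ht'⟩
    | smul r a _ ha =>
      obtain ⟨t, ht⟩ := ha
      exact ⟨r • t, by rw [map_smul, smul_mul_assoc]; exact Submodule.smul_mem _ r ht⟩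

end CliffordOrderedProducts

/-! ### Cohomology modulo a regular sequence of coboundaries -/

namespace DiffSuperAlgebra

variable {k A : Type*} [CommRing k] [Ring A] [Algebra k A] (D : DiffSuperAlgebra k A)

/-- `p 0, …, p (n - 1)` is a regular sequence of central elements of `A` generating the
ideals `I i`, and each `p i` is the coboundary of the odd element `C i`. -/
structure IsRegularTransgressive (n : ℕ) (p C : ℕ → A) (I : ℕ → AddSubgroup A) : Prop where
  zero : I 0 = ⊥
  mem_succ : ∀ i < n, ∀ x, x ∈ I (i + 1) ↔ ∃ y, ∃ u ∈ I i, x = p i * y + u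
  d_mem : ∀ i ≤ n, ∀ x ∈ I i, D.d x ∈ I i
  mul_mem : ∀ i ≤ n, ∀ a, ∀ x ∈ I i, a * x ∈ I i
  regular : ∀ i < n, ∀ y, p i * y ∈ I i → y ∈ I i
  central : ∀ i < n, ∀ y, p i * y = y * p i
  parity_C : ∀ i < n, D.parity (C i) = -C i
  d_C : ∀ i < n, D.d (C i) = p i

namespace IsRegularTransgressive

variable {D} {n : ℕ} {p C : ℕ → A} {I : ℕ → AddSubgroup A}
  (h : D.IsRegularTransgressive n p C I)

include h

theorem d_C_mul {i : ℕ} (hi : i < n) (y : A) :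
    D.d (C i * y) = p i * y - C i * D.d y := by
  rw [D.d_mul, h.d_C i hi, h.parity_C i hi, neg_mul, sub_eq_add_neg]

theorem d_p_mul {i : ℕ} (hi : i < n) (y : A) : D.d (p i * y) = p i * D.d y := by
  have h1 : D.parity (p i) = p i := by
    have := D.d_parity (C i)
    rw [h.parity_C i hi, map_neg, h.d_C i hi] at this
    exact (neg_injective this).symm
  have h2 : D.d (p i) = 0 := by rw [← h.d_C i hi, D.d_d]
  rw [D.d_mul, h1, h2, zero_mul, zero_add]

theorem le_succ {i : ℕ} (hi : i < n) {x : A} (hx : x ∈ I i) : x ∈ I (i + 1) :=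
  (h.mem_succ i hi x).2 ⟨0, x, hx, by rw [mul_zero, zero_add]⟩

theorem p_mul_mem {i : ℕ} (hi : i < n) (y : A) : p i * y ∈ I (i + 1) :=
  (h.mem_succ i hi _).2 ⟨y, 0, zero_mem _, by rw [add_zero]⟩

variable {U : Type*} [Ring U] [Algebra k U] {v : ℕ → U}

/-- Each `C j` with `j < i` is a cocycle modulo `I i`, because its coboundary is `p j`. -/
theorem d_mem_of_mem_orderedProductSpan {i : ℕ} (hi : i ≤ n) {x : U × A}
    (hx : x ∈ orderedProductSpan (k := k) v C i) : D.d x.2 ∈ I i := by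
  induction i generalizing x with
  | zero =>
    obtain ⟨r, rfl⟩ := mem_orderedProductSpan_zero.1 hx
    rw [Prod.smul_snd, Prod.snd_one, map_smul, D.d_one, smul_zero]
    exact zero_mem _
  | succ i ih =>
    obtain ⟨x, hx', y, hy, rfl⟩ := mem_orderedProductSpan_succ.1 hx
    rw [Prod.snd_add, Prod.snd_mul, map_add, h.d_C_mul hi]
    exact add_mem (h.le_succ hi (ih (by omega) hx')) (sub_mem (h.p_mul_mem hi _)
      (h.mul_mem _ hi _ _ (h.le_succ hi (ih (by omega) hy))))

/-- If `d z = p i * y + u`, regularity makes `y` a cocycle modulo `I i`, so by induction `y` is an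
ordered combination `t` plus `d y'`. Then `z - C i * t - p i * y'` is a cocycle modulo `I i`, and
induction applies to it as well. -/
theorem exists_sub_mem (hH : ∀ z, D.d z = 0 → ∃ (r : k) (y : A), z = algebraMap k A r + D.d y)
    {i : ℕ} (hi : i ≤ n) {z : A} (hz : D.d z ∈ I i) :
    ∃ x ∈ orderedProductSpan (k := k) v C i, ∃ y, z - x.2 - D.d y ∈ I i := by
  induction i generalizing z with
  | zero =>
    rw [h.zero, AddSubgroup.mem_bot] at hz
    obtain ⟨r, y, hy⟩ := hH z hz
    refine ⟨r • 1, mem_orderedProductSpan_zero.2 ⟨r, rfl⟩, y, ?_⟩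
    rw [hy, Prod.smul_snd, Prod.snd_one, ← Algebra.algebraMap_eq_smul_one, add_sub_cancel_left,
      sub_self]
    exact zero_mem _
  | succ i ih =>
    have hi' : i ≤ n := Nat.le_of_succ_le hi
    obtain ⟨y, u, hu, hzy⟩ := (h.mem_succ i hi _).1 hz
    have hdy : D.d y ∈ I i := by
      apply h.regular i hi
      have h1 := congrArg D.d hzy
      rw [D.d_d, map_add, h.d_p_mul hi] at h1
      rw [eq_neg_of_add_eq_zero_left h1.symm]
      exact neg_mem (h.d_mem i hi' u hu)
    obtain ⟨t, ht, y', hy'⟩ := ih hi' hdy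
    obtain ⟨s, hs, y'', hy''⟩ := ih hi' (z := z - C i * t.2 - p i * y') (by
      have e : D.d (z - C i * t.2 - p i * y') =
          p i * (y - t.2 - D.d y') + u + C i * D.d t.2 := by
        rw [map_sub, map_sub, h.d_C_mul hi, h.d_p_mul hi, hzy]
        noncomm_ring
      rw [e]
      exact add_mem (add_mem (h.mul_mem i hi' _ _ hy') hu)
        (h.mul_mem i hi' _ _ (h.d_mem_of_mem_orderedProductSpan hi' ht)))
    refine ⟨s + (v i, C i) * t, mem_orderedProductSpan_succ.2 ⟨s, hs, t, ht, rfl⟩, y'', ?_⟩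
    have e : z - (s + (v i, C i) * t).2 - D.d y'' =
        p i * y' + (z - C i * t.2 - p i * y' - s.2 - D.d y'') := by
      rw [Prod.snd_add, Prod.snd_mul]
      noncomm_ring
    rw [e]
    exact add_mem (h.p_mul_mem hi _) (h.le_succ hi hy'')

/-- Suppose `s + C i * t - d y = p i * a + u`. Differentiating and cancelling `p i` shows that `t`
is a coboundary modulo `I i`, so `t = 0` by induction. Then `a` is a cocycle modulo `I i`, equal to
some `b + d y'` there by `exists_sub_mem`, so `p i * a` agrees with `d (C i * b + p i * y')`, and
induction gives `s = 0`. The whole pair vanishes, which yields injectivity on the Clifford side. -/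
theorem eq_zero_of_sub_mem (hH : ∀ z, D.d z = 0 → ∃ (r : k) (y : A), z = algebraMap k A r + D.d y)
    (hinj : ∀ (r : k) (y : A), algebraMap k A r = D.d y → r = 0)
    {i : ℕ} (hi : i ≤ n) {x : U × A} (hx : x ∈ orderedProductSpan (k := k) v C i) {y : A}
    (hy : x.2 - D.d y ∈ I i) : x = 0 := by
  induction i generalizing x y with
  | zero =>
    obtain ⟨r, rfl⟩ := mem_orderedProductSpan_zero.1 hx
    rw [h.zero, AddSubgroup.mem_bot, sub_eq_zero, Prod.smul_snd, Prod.snd_one,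
      ← Algebra.algebraMap_eq_smul_one] at hy
    rw [hinj r y hy, zero_smul]
  | succ i ih =>
    have hi' : i ≤ n := Nat.le_of_succ_le hi
    obtain ⟨s, hs, t, ht, rfl⟩ := mem_orderedProductSpan_succ.1 hx
    obtain ⟨a, u, hu, hau⟩ := (h.mem_succ i hi _).1 hy
    rw [Prod.snd_add, Prod.snd_mul] at hau
    have hds := h.d_mem_of_mem_orderedProductSpan hi' hs
    have hdt := h.d_mem_of_mem_orderedProductSpan hi' ht
    have ht0 : t = 0 := by
      refine ih hi' ht (y := a) (h.regular i hi _ ?_)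
      have e := congrArg D.d hau
      rw [map_sub, map_add, D.d_d, h.d_C_mul hi, map_add, h.d_p_mul hi] at e
      have e' : p i * (t.2 - D.d a) = D.d u - D.d s.2 + C i * D.d t.2 := by
        have : p i * t.2 = p i * D.d a + D.d u - D.d s.2 + C i * D.d t.2 := by
          rw [← e]; abel
        rw [mul_sub, this]
        abel
      rw [e']
      exact add_mem (sub_mem (h.d_mem i hi' u hu) hds) (h.mul_mem i hi' _ _ hdt)
    subst ht0
    rw [mul_zero, add_zero]
    rw [Prod.snd_zero, mul_zero, add_zero] at hau
    have hda : D.d a ∈ I i := by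
      apply h.regular i hi
      have e := congrArg D.d hau
      rw [map_sub, D.d_d, sub_zero, map_add, h.d_p_mul hi] at e
      rw [← sub_eq_iff_eq_add.2 e]
      exact sub_mem hds (h.d_mem i hi' u hu)
    obtain ⟨b, hb, y', hy'⟩ := h.exists_sub_mem (v := v) hH hi' hda
    have hdb := h.d_mem_of_mem_orderedProductSpan hi' hb
    refine ih hi' hs (y := y + p i * y' + C i * b.2) ?_
    have e : s.2 - D.d (y + p i * y' + C i * b.2) =
        p i * (a - b.2 - D.d y') + u + C i * D.d b.2 := by
      rw [map_add, map_add, h.d_p_mul hi, h.d_C_mul hi, sub_eq_iff_eq_add.1 hau]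
      noncomm_ring
    rw [e]
    exact add_mem (add_mem (h.mul_mem i hi' _ _ hy') hu) (h.mul_mem i hi' _ _ hdb)

end IsRegularTransgressive

end DiffSuperAlgebra

/-! ### Transport from polynomials to the symmetric algebra -/

theorem Subalgebra.free_of_algEquiv {k A B : Type*} [CommRing k] [CommRing A] [CommRing B]
    [Algebra k A] [Algebra k B] (e : A ≃ₐ[k] B) {S : Subalgebra k A} {T : Subalgebra k B}
    (h : ∀ x, x ∈ S ↔ e x ∈ T) [Module.Free S A] : Module.Free T B := by
  let E : S ≃+* T :=
    { toFun := fun x => ⟨e x.1, (h _).1 x.2⟩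
      invFun := fun x => ⟨e.symm x.1, by rw [h, e.apply_symm_apply]; exact x.2⟩
      left_inv := fun x => Subtype.ext (e.symm_apply_apply _)
      right_inv := fun x => Subtype.ext (e.apply_symm_apply _)
      map_mul' := fun x y => Subtype.ext (map_mul e x.1 y.1)
      map_add' := fun x y => Subtype.ext (map_add e x.1 y.1) }
  have := RingHomInvPair.of_ringEquiv E
  have := RingHomInvPair.of_ringEquiv_symm E
  let L : A ≃ₛₗ[(E : S →+* T)] B :=
    { e.toAddEquiv with
      map_smul' := fun r x => map_mul e r.1 x }
  exact Module.Free.of_equiv L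

section Transport

variable {k V : Type*} [Field k] [AddCommGroup V] [Module k V]

theorem symMap_ι (g : V ≃ₗ[k] V) (x : V) :
    symMap g (SymAlgebra.ι k V x) = SymAlgebra.ι k V (g x) :=
  SymmetricAlgebra.lift_ι_apply _ x

theorem symMap_one (f : SymAlgebra k V) : symMap (1 : V ≃ₗ[k] V) f = f := by
  induction f using SymAlgebra.induction with
  | algebraMap r => exact AlgHom.commutes _ r
  | ι x => exact symMap_ι _ x
  | mul a b ha hb => rw [map_mul, ha, hb]
  | add a b ha hb => rw [map_add, ha, hb]

theorem symMap_mul (g h : V ≃ₗ[k] V) (f : SymAlgebra k V) :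
    symMap (g * h) f = symMap g (symMap h f) := by
  induction f using SymAlgebra.induction with
  | algebraMap r => simp only [AlgHom.commutes]
  | ι x => simp only [symMap_ι]; rfl
  | mul a b ha hb => simp only [map_mul, ha, hb]
  | add a b ha hb => simp only [map_add, ha, hb]

/-- The map `f ↦ g f - f` is a twisted derivation, so divisibility needs checking only on `V`. -/
theorem ι_dvd_symMap_sub {g : V ≃ₗ[k] V} {u : V} (hu : ∀ x, ∃ c : k, c • u = g x - x)
    (f : SymAlgebra k V) : SymAlgebra.ι k V u ∣ symMap g f - f := by
  induction f using SymAlgebra.induction with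
  | algebraMap r => rw [AlgHom.commutes, sub_self]; exact dvd_zero _
  | ι x =>
    obtain ⟨c, hc⟩ := hu x
    rw [symMap_ι, ← map_sub, ← hc, map_smul, Algebra.smul_def]
    exact dvd_mul_left _ _
  | mul a b ha hb =>
    rw [map_mul, show symMap g a * symMap g b - a * b =
      (symMap g a - a) * symMap g b + a * (symMap g b - b) by ring]
    exact dvd_add (dvd_mul_of_dvd_left ha _) (dvd_mul_of_dvd_right hb _)
  | add a b ha hb =>
    rw [map_add, add_sub_add_comm]
    exact dvd_add ha hb

variable {κ : Type*} (e : Module.Basis κ k V)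

theorem map_symDegree (m : ℕ) :
    (symDegree k V m).map (symEquivMvPolynomial e).toLinearMap =
      MvPolynomial.homogeneousSubmodule κ k m := by
  have h1 : (LinearMap.range (SymAlgebra.ι k V)).map (symEquivMvPolynomial e).toLinearMap =
      MvPolynomial.homogeneousSubmodule κ k 1 := by
    rw [MvPolynomial.homogeneousSubmodule_one_eq_span_X, ← Submodule.map_top, ← e.span_eq,
      Submodule.map_span, Submodule.map_span, ← Set.range_comp, ← Set.range_comp]
    congr 2
    exact funext fun a => symEquivMvPolynomial_ι e a
  rw [← MvPolynomial.homogeneousSubmodule_one_pow, ← h1, symDegree]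
  exact Submodule.map_pow _ (symEquivMvPolynomial e).toAlgHom m

theorem mem_symDegree_iff {m : ℕ} {f : SymAlgebra k V} :
    f ∈ symDegree k V m ↔ (symEquivMvPolynomial e f).IsHomogeneous m := by
  rw [← MvPolynomial.mem_homogeneousSubmodule, ← map_symDegree e]
  constructor
  · exact fun h => ⟨f, h, rfl⟩
  · rintro ⟨g, hg, h⟩
    exact (symEquivMvPolynomial e).injective h ▸ hg

theorem isHomogeneous_symEquivMvPolynomial_ι (x : V) :
    (symEquivMvPolynomial e (SymAlgebra.ι k V x)).IsHomogeneous 1 := by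
  rw [← mem_symDegree_iff, symDegree, pow_one]
  exact ⟨x, rfl⟩

/-- The action of a group of automorphisms of `V` on polynomials in a basis of `V`. -/
abbrev polynomialAction (W : Subgroup (V ≃ₗ[k] V)) :
    MulSemiringAction W (MvPolynomial κ k) where
  smul g f := symEquivMvPolynomial e (symMap g.1 ((symEquivMvPolynomial e).symm f))
  one_smul f := by
    change symEquivMvPolynomial e (symMap 1 _) = f
    rw [symMap_one, AlgEquiv.apply_symm_apply]
  mul_smul g h f := by
    change symEquivMvPolynomial e (symMap (g.1 * h.1) _) = symEquivMvPolynomial e (symMap g.1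
      ((symEquivMvPolynomial e).symm (symEquivMvPolynomial e (symMap h.1 _))))
    rw [symMap_mul, AlgEquiv.symm_apply_apply]
  smul_zero g := by
    change symEquivMvPolynomial e (symMap g.1 ((symEquivMvPolynomial e).symm 0)) = 0
    simp only [map_zero]
  smul_add g x y := by
    change symEquivMvPolynomial e (symMap g.1 ((symEquivMvPolynomial e).symm (x + y))) = _
    simp only [map_add]
    rfl
  smul_one g := by
    change symEquivMvPolynomial e (symMap g.1 ((symEquivMvPolynomial e).symm 1)) = 1
    simp only [map_one]
  smul_mul g x y := by
    change symEquivMvPolynomial e (symMap g.1 ((symEquivMvPolynomial e).symm (x * y))) = _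
    simp only [map_mul]
    rfl

section

variable (W : Subgroup (V ≃ₗ[k] V))

theorem polynomialAction_smul (g : W) (f : MvPolynomial κ k) :
    letI := polynomialAction e W
    g • f = symEquivMvPolynomial e (symMap g.1 ((symEquivMvPolynomial e).symm f)) := rfl

theorem polynomialAction_smulCommClass :
    letI := polynomialAction e W
    SMulCommClass W k (MvPolynomial κ k) :=
  let := polynomialAction e W
  ⟨fun g c f => by simp only [polynomialAction_smul, map_smul]⟩

theorem polynomialAction_isGradedAction :
    letI := polynomialAction e W
    MvPolynomial.IsGradedAction κ k W := by
  let := polynomialAction e W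
  intro g n f hf
  let φ : MvPolynomial κ k →ₐ[k] MvPolynomial κ k :=
    (symEquivMvPolynomial e).toAlgHom.comp
      ((symMap g.1).comp (symEquivMvPolynomial e).symm.toAlgHom)
  have hφ : φ = MvPolynomial.aeval fun i =>
      symEquivMvPolynomial e (SymAlgebra.ι k V (g.1 (e i))) := by
    refine MvPolynomial.algHom_ext fun i => ?_
    rw [MvPolynomial.aeval_X, ← symMap_ι]
    change symEquivMvPolynomial e (symMap g.1 ((symEquivMvPolynomial e).symm _)) = _
    rw [← symEquivMvPolynomial_ι e, AlgEquiv.symm_apply_apply]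
  change (φ f).IsHomogeneous n
  rw [hφ]
  simpa using hf.aeval _ fun i => isHomogeneous_symEquivMvPolynomial_ι e (g.1 (e i))

theorem SymAlgebra.ι_ne_zero [Fintype κ] (e : Module.Basis κ k V) {x : V} (hx : x ≠ 0) :
    SymAlgebra.ι k V x ≠ 0 := fun h =>
  hx (by rw [← linearPart_ι e x, h, map_zero])

variable {W}

theorem polynomialAction_isGeneratedByReflections [Fintype κ] (hW : IsFiniteReflectionGroup W) :
    letI := polynomialAction e W
    MvPolynomial.IsGeneratedByReflections κ k W := by
  let := polynomialAction e W
  rw [MvPolynomial.IsGeneratedByReflections, eq_top_iff]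
  intro g _
  -- Generation is given inside the automorphisms of `V` and is pulled back to `W` along the
  -- inclusion; the linear form comes from a vector spanning the range of `s - 1`.
  have h1 : Subgroup.closure {g | g ∈ W ∧ IsReflectionMap g} ≤ (Subgroup.closure
      {s : W | ∃ u : MvPolynomial κ k, u.IsHomogeneous 1 ∧ u ≠ 0 ∧
        ∀ f : MvPolynomial κ k, u ∣ s • f - f}).map W.subtype := by
    rw [Subgroup.closure_le]
    rintro s ⟨hsW, hs⟩
    refine ⟨⟨s, hsW⟩, Subgroup.subset_closure ?_, rfl⟩
    obtain ⟨u, hu0, hu⟩ := finrank_eq_one_iff'.1 hs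
    refine ⟨symEquivMvPolynomial e (SymAlgebra.ι k V u.1),
      isHomogeneous_symEquivMvPolynomial_ι e _, ?_, fun f => ?_⟩
    · rw [Ne, map_eq_zero_iff _ (symEquivMvPolynomial e).injective]
      exact SymAlgebra.ι_ne_zero e fun h => hu0 (Subtype.ext h)
    · have h2 := ι_dvd_symMap_sub (g := s) (u := u.1) (fun x => by
        obtain ⟨c, hc⟩ := hu ⟨_, x, rfl⟩
        exact ⟨c, congrArg Subtype.val hc⟩) ((symEquivMvPolynomial e).symm f)
      have h3 := map_dvd (symEquivMvPolynomial e) h2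
      rwa [map_sub, AlgEquiv.apply_symm_apply] at h3
  rw [hW.2] at h1
  obtain ⟨g', hg', hgg⟩ := h1 g.2
  rwa [← Subtype.ext (a1 := g') (a2 := g) hgg]

theorem mem_invariants_iff {f : SymAlgebra k V} :
    letI := polynomialAction e W
    letI := polynomialAction_smulCommClass e W
    f ∈ invariants W ↔
      symEquivMvPolynomial e f ∈ FixedPoints.subalgebra k (MvPolynomial κ k) W := by
  let := polynomialAction e W
  have := polynomialAction_smulCommClass e W
  constructor
  · intro h g
    change symEquivMvPolynomial e (symMap g.1 ((symEquivMvPolynomial e).symm _)) = _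
    rw [AlgEquiv.symm_apply_apply, h g.1 g.2]
  · intro h g hg
    have h1 : symEquivMvPolynomial e (symMap g ((symEquivMvPolynomial e).symm _)) = _ := h ⟨g, hg⟩
    rw [AlgEquiv.symm_apply_apply] at h1
    exact (symEquivMvPolynomial e).injective h1

end

variable [CharZero k] [FiniteDimensional k V] {W : Subgroup (V ≃ₗ[k] V)}

theorem exists_isInvariantGenerators (hW : IsFiniteReflectionGroup W) :
    ∃ (p : Fin (Module.finrank k V) → SymAlgebra k V) (m : Fin (Module.finrank k V) → ℕ),
      IsInvariantGenerators W p m := by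
  let e := Module.finBasis k V
  let := polynomialAction e W
  have := polynomialAction_smulCommClass e W
  have := hW.1
  let := Fintype.ofFinite W
  obtain ⟨f, m, hm, hind, hadj⟩ :=
    MvPolynomial.exists_algebraicIndependent_adjoin_eq_fixedPoints
      (polynomialAction_isGradedAction e W) (polynomialAction_isGeneratedByReflections e hW)
  refine ⟨fun j => (symEquivMvPolynomial e).symm (f j), m, fun j => ?_, ?_, ?_⟩
  · rw [mem_symDegree_iff e, AlgEquiv.apply_symm_apply]
    exact hm j
  · exact hind.map' (f := (symEquivMvPolynomial e).symm.toAlgHom)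
      (symEquivMvPolynomial e).symm.injective
  · have h1 := congrArg (Subalgebra.map (symEquivMvPolynomial e).symm.toAlgHom) hadj
    rw [AlgHom.map_adjoin, ← Set.range_comp] at h1
    refine h1.trans (SetLike.ext fun x => ?_)
    rw [mem_invariants_iff e]
    constructor
    · rintro ⟨y, hy, rfl⟩
      change symEquivMvPolynomial e ((symEquivMvPolynomial e).symm y) ∈ _
      rwa [AlgEquiv.apply_symm_apply]
    · exact fun h => ⟨_, h, (symEquivMvPolynomial e).symm_apply_apply x⟩

theorem free_invariants (hW : IsFiniteReflectionGroup W) :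
    Module.Free (invariants W) (SymAlgebra k V) := by
  let e := Module.finBasis k V
  let := polynomialAction e W
  have := polynomialAction_smulCommClass e W
  have := hW.1
  let := Fintype.ofFinite W
  have hfree := MvPolynomial.free_fixedPoints (polynomialAction_isGradedAction e W)
    (polynomialAction_isGeneratedByReflections e hW)
  exact Subalgebra.free_of_algEquiv (symEquivMvPolynomial e).symm
    (fun x => by rw [mem_invariants_iff e, AlgEquiv.apply_symm_apply])

/-- The Koszul algebra is a base change from `k` to `SV`, hence free over `SV`, and freeness is
transitive. -/
theorem free_koszulAlgebra (hW : IsFiniteReflectionGroup W) (Q : QuadraticForm k V) :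
    Module.Free (invariants W) (KoszulAlgebra Q) :=
  have := free_invariants hW
  Module.Free.trans (S := SymAlgebra k V)

end Transport

/-! ### Regular sequences on free modules -/

section FreeRegular

theorem mem_ideal_smul_top_iff {R M κ : Type*} [CommRing R] [AddCommGroup M] [Module R M]
    (b : Module.Basis κ R M) (J : Ideal R) (y : M) :
    y ∈ J • (⊤ : Submodule R M) ↔ ∀ j, b.repr y j ∈ J := by
  constructor
  · intro h j
    induction h using Submodule.smul_induction_on' with
    | smul r hr x _ =>
      rw [map_smul, Finsupp.smul_apply, smul_eq_mul]
      exact J.mul_mem_right _ hr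
    | add x _ y _ hx hy =>
      rw [map_add, Finsupp.add_apply]
      exact add_mem hx hy
  · intro h
    rw [← b.linearCombination_repr y]
    exact sum_mem fun j _ => Submodule.smul_mem_smul (h j) trivial

/-- Regularity modulo `J` passes from the ring to a free module coordinate by coordinate. -/
theorem mem_smul_top_of_smul_mem {R M : Type*} [CommRing R] [AddCommGroup M] [Module R M]
    [Module.Free R M] {J : Ideal R} {r : R} (hr : ∀ s, r * s ∈ J → s ∈ J) {y : M}
    (hy : r • y ∈ J • (⊤ : Submodule R M)) : y ∈ J • (⊤ : Submodule R M) := by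
  let b := Module.Free.chooseBasis R M
  rw [mem_ideal_smul_top_iff b] at hy ⊢
  intro j
  have := hy j
  rw [map_smul, Finsupp.smul_apply, smul_eq_mul] at this
  exact hr _ this

/-- The ideal is monomial, and multiplication by `X i` leaves the exponents at indices in `s`
unchanged. -/
theorem MvPolynomial.mem_span_X_image_of_X_mul_mem {κ k : Type*} [Field k] {s : Set κ} {i : κ}
    (hi : i ∉ s) {f : MvPolynomial κ k}
    (hf : X i * f ∈ Ideal.span (X '' s : Set (MvPolynomial κ k))) :
    f ∈ Ideal.span (X '' s : Set (MvPolynomial κ k)) := by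
  classical
  rw [mem_ideal_span_X_image] at hf ⊢
  intro m hm
  obtain ⟨j, hj, hj0⟩ := hf (Finsupp.single i 1 + m) (by
    rw [mem_support_iff, coeff_X_mul]
    exact mem_support_iff.1 hm)
  refine ⟨j, hj, ?_⟩
  have hij : i ≠ j := fun h => hi (h ▸ hj)
  simpa [Finsupp.single_apply, hij] using hj0

end FreeRegular

/-! ### Cochains of transgression and the form on the generators -/

section Transgression

open CliffordAlgebra

variable {k V : Type*} [Field k] [AddCommGroup V] [Module k V]

section Degrees

variable {κ : Type*} [Fintype κ] (e : Module.Basis κ k V)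

theorem augmentation_eq_coeff_zero (f : SymAlgebra k V) :
    SymAlgebra.augmentation k V f = MvPolynomial.coeff 0 (symEquivMvPolynomial e f) := by
  rw [← MvPolynomial.constantCoeff_eq]
  induction f using SymAlgebra.induction with
  | algebraMap r =>
    rw [AlgHom.commutes, AlgEquiv.commutes, MvPolynomial.algebraMap_eq,
      MvPolynomial.constantCoeff_C]
    rfl
  | ι x =>
    rw [SymAlgebra.augmentation_ι, MvPolynomial.constantCoeff_eq]
    exact ((isHomogeneous_symEquivMvPolynomial_ι e x).coeff_eq_zero (by simp)).symm
  | mul a b ha hb => rw [map_mul, map_mul, map_mul, ha, hb]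
  | add a b ha hb => rw [map_add, map_add, map_add, ha, hb]

theorem linearPart_eq_zero {m : ℕ} (hm : 2 ≤ m) {f : SymAlgebra k V}
    (hf : f ∈ symDegree k V m) : linearPart e f = 0 := by
  rw [linearPart_apply]
  refine Finset.sum_eq_zero fun a _ => ?_
  rw [augmentation_eq_coeff_zero e, partialD, AlgEquiv.apply_symm_apply,
    (((mem_symDegree_iff e).1 hf).pderiv).coeff_eq_zero, zero_smul]
  simp only [map_zero]
  omega

theorem sum_ι_mul_partialD {m : ℕ} {f : SymAlgebra k V} (hf : f ∈ symDegree k V m) :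
    ∑ a, SymAlgebra.ι k V (e a) * partialD e a f = (m : k) • f := by
  apply (symEquivMvPolynomial e).injective
  rw [map_sum, map_smul, Nat.cast_smul_eq_nsmul,
    ← ((mem_symDegree_iff e).1 hf).sum_X_mul_pderiv]
  refine Finset.sum_congr rfl fun a _ => ?_
  rw [map_mul, symEquivMvPolynomial_ι, partialD, AlgEquiv.apply_symm_apply]

theorem IsInvariantGenerators.degree_ne_zero {W : Subgroup (V ≃ₗ[k] V)} {n : ℕ}
    {p : Fin n → SymAlgebra k V} {m : Fin n → ℕ} (hp : IsInvariantGenerators W p m)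
    (e : Module.Basis κ k V) (i : Fin n) : m i ≠ 0 := by
  intro h
  have h1 := (mem_symDegree_iff e).1 (hp.homogeneous i)
  rw [h, ← MvPolynomial.totalDegree_zero_iff_isHomogeneous,
    MvPolynomial.totalDegree_eq_zero_iff_eq_C, ← MvPolynomial.algebraMap_eq] at h1
  have h2 : p i = algebraMap k _ (MvPolynomial.coeff 0 (symEquivMvPolynomial e (p i))) :=
    (symEquivMvPolynomial e).injective (by rw [AlgEquiv.commutes]; exact h1)
  refine hp.algebraicIndependent.transcendental i ?_
  rw [h2]
  exact isAlgebraic_algebraMap _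

variable [FiniteDimensional k V] (Q : QuadraticForm k V)

theorem koszulD_tmul_ι (f : SymAlgebra k V) (x : V) :
    koszulD Q (f ⊗ₜ ι Q x) = (f * SymAlgebra.ι k V x) ⊗ₜ 1 := by
  have h : f ⊗ₜ[k] ι Q x = f ⊗ₜ[k] 1 * (1 ⊗ₜ[k] ι Q x) := by
    rw [Algebra.TensorProduct.tmul_mul_tmul, mul_one, one_mul]
  rw [h, koszulD_tmul_one_mul, koszulD_ι, Algebra.TensorProduct.tmul_mul_tmul, one_mul]

variable [CharZero k]

theorem isTransgressionCochain_transgressionCochain {m : ℕ} (hm : m ≠ 0) {f : SymAlgebra k V}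
    (hf : f ∈ symDegree k V m) :
    IsTransgressionCochain Q f (transgressionCochain e Q m f) := by
  constructor
  · change koszulParity Q _ = _
    simp [transgressionCochain, koszulParity_tmul, TensorProduct.tmul_neg]
  · change koszulD Q _ = _
    simp only [transgressionCochain, map_smul, map_sum, koszulD_tmul_ι]
    rw [← TensorProduct.sum_tmul, TensorProduct.smul_tmul']
    congr 1
    rw [inv_smul_eq_iff₀ (Nat.cast_ne_zero.2 hm), ← sum_ι_mul_partialD e hf]
    exact Finset.sum_congr rfl fun a _ => mul_comm _ _

/-- The factor `1 / m` leaves no trace: it is `1` in degree one, and in higher degrees the linear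
part vanishes. -/
theorem koszulAug_transgressionCochain {m : ℕ} (hm : m ≠ 0) {f : SymAlgebra k V}
    (hf : f ∈ symDegree k V m) :
    koszulAug Q (transgressionCochain e Q m f) = ι Q (linearPart e f) := by
  have h1 : koszulAug Q (transgressionCochain e Q m f) = (m : k)⁻¹ • ι Q (linearPart e f) := by
    simp only [transgressionCochain, map_smul, map_sum, koszulAug_tmul, linearPart_apply]
  rw [h1]
  rcases Nat.lt_or_ge m 2 with h | h
  · obtain rfl : m = 1 := by omega
    rw [Nat.cast_one, inv_one, one_smul]
  · rw [linearPart_eq_zero e h hf, map_zero, smul_zero]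

end Degrees

theorem tmul_one_mul_comm {Q : QuadraticForm k V} (f : SymAlgebra k V)
    (z : KoszulAlgebra Q) :
    f ⊗ₜ 1 * z = z * f ⊗ₜ 1 := by
  induction z using TensorProduct.induction_on with
  | zero => simp
  | add x y hx hy => rw [mul_add, add_mul, hx, hy]
  | tmul g c => simp [Algebra.TensorProduct.tmul_mul_tmul, mul_comm]

variable [FiniteDimensional k V] [CharZero k] {Q : QuadraticForm k V}

/-- The difference is an odd cocycle, whereas scalars are even, so its scalar part satisfies `r =
-r`. -/
theorem IsTransgressionCochain.exists_sub_eq {f : SymAlgebra k V} {C C' : KoszulAlgebra Q}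
    (hC : IsTransgressionCochain Q f C) (hC' : IsTransgressionCochain Q f C') :
    ∃ y, C - C' = koszulD Q y := by
  have h2 : Invertible (2 : k) := invertibleOfNonzero two_ne_zero
  obtain ⟨hp, hd⟩ := hC
  obtain ⟨hp', hd'⟩ := hC'
  change koszulParity Q C = _ at hp
  change koszulParity Q C' = _ at hp'
  change koszulD Q C = _ at hd
  change koszulD Q C' = _ at hd'
  obtain ⟨r, y, hy⟩ := exists_eq_add_koszulD Q (z := C - C') (by rw [map_sub, hd, hd', sub_self])
  have h1 : koszulAug Q (C - C') = algebraMap k _ r := by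
    rw [hy, map_add, koszulAug_koszulD, add_zero, AlgHom.commutes]
  have h3 : koszulParity Q (C - C') = -(C - C') := by rw [map_sub, hp, hp']; abel
  have h4 := congrArg (koszulAug Q) h3
  rw [koszulAug_koszulParity, map_neg, h1, AlgHom.commutes, ← map_neg] at h4
  have h5 := (algebraMap k (CliffordAlgebra Q)).injective h4
  rw [self_eq_neg] at h5
  exact ⟨y, by rw [hy, h5, map_zero, zero_add]⟩

/-- The coboundary is `f C' - C g + g C - C' f`, which vanishes because `SV` is central. -/
theorem koszulD_anticommutator {f g : SymAlgebra k V} {C C' : KoszulAlgebra Q}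
    (hC : IsTransgressionCochain Q f C) (hC' : IsTransgressionCochain Q g C') :
    koszulD Q (C * C' + C' * C) = 0 := by
  obtain ⟨hp, hd⟩ := hC
  obtain ⟨hp', hd'⟩ := hC'
  change koszulParity Q C = _ at hp
  change koszulParity Q C' = _ at hp'
  change koszulD Q C = _ at hd
  change koszulD Q C' = _ at hd'
  rw [map_add, koszulD_mul, koszulD_mul, hp, hp', hd, hd', tmul_one_mul_comm f,
    tmul_one_mul_comm g]
  noncomm_ring

/-- A linear choice of cochains of transgression with prescribed image in `Cl(V, Q)`. -/
theorem exists_linear_transgressionCochain {W : Subgroup (V ≃ₗ[k] V)} {n : ℕ}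
    {p : Fin n → SymAlgebra k V} {m : Fin n → ℕ} (hp : IsInvariantGenerators W p m)
    (Q : QuadraticForm k V) :
    ∃ c : Submodule.span k (Set.range p) →ₗ[k] KoszulAlgebra Q,
      ∀ x : Submodule.span k (Set.range p), IsTransgressionCochain Q x (c x) ∧
        koszulAug Q (c x) = ι Q (linearPart (Module.finBasis k V) (x : SymAlgebra k V)) := by
  let b := Module.Basis.span hp.algebraicIndependent.linearIndependent
  have hb : ∀ i, (b i : SymAlgebra k V) = p i := fun i =>
    congrArg Subtype.val (Module.Basis.span_apply _ i)
  let c := b.constr k fun i => transgressionCochain (Module.finBasis k V) Q (m i) (p i)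
  have hc : ∀ i, c (b i) = transgressionCochain (Module.finBasis k V) Q (m i) (p i) :=
    fun i => b.constr_basis k _ i
  have ht := fun i => isTransgressionCochain_transgressionCochain (Module.finBasis k V) Q
    (hp.degree_ne_zero (Module.finBasis k V) i) (hp.homogeneous i)
  have h1 : (koszulParity Q).toLinearMap ∘ₗ c = -c := b.ext fun i => by
    rw [LinearMap.comp_apply, LinearMap.neg_apply, hc]
    exact (ht i).1
  have h2 : koszulD Q ∘ₗ c = (Algebra.TensorProduct.includeLeft (R := k) (S := k)
      (A := SymAlgebra k V) (B := CliffordAlgebra Q)).toLinearMap ∘ₗ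
        (Submodule.span k (Set.range p)).subtype := b.ext fun i => by
    rw [LinearMap.comp_apply, hc, LinearMap.comp_apply, Submodule.subtype_apply, hb]
    exact (ht i).2
  have h3 : (koszulAug Q).toLinearMap ∘ₗ c = ι Q ∘ₗ linearPart (Module.finBasis k V) ∘ₗ
      (Submodule.span k (Set.range p)).subtype := b.ext fun i => by
    rw [LinearMap.comp_apply, hc, LinearMap.comp_apply, LinearMap.comp_apply,
      Submodule.subtype_apply, hb]
    exact koszulAug_transgressionCochain _ Q
      (hp.degree_ne_zero (Module.finBasis k V) i) (hp.homogeneous i)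
  exact ⟨c, fun x => ⟨⟨LinearMap.congr_fun h1 x, LinearMap.congr_fun h2 x⟩,
    LinearMap.congr_fun h3 x⟩⟩

/-- Cochains for the same element differ by a coboundary, which the augmentation kills, so one
linear choice determines the value for all, including inhomogeneous `x`. -/
theorem IsTransgressionCochain.koszulAug_eq {W : Subgroup (V ≃ₗ[k] V)} {n : ℕ}
    {p : Fin n → SymAlgebra k V} {m : Fin n → ℕ} (hp : IsInvariantGenerators W p m)
    {x : Submodule.span k (Set.range p)} {C : KoszulAlgebra Q}
    (hC : IsTransgressionCochain Q x C) :
    koszulAug Q C = ι Q (linearPart (Module.finBasis k V) (x : SymAlgebra k V)) := by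
  obtain ⟨c, hc⟩ := exists_linear_transgressionCochain hp Q
  obtain ⟨y, hy⟩ := hC.exists_sub_eq (hc x).1
  have h := congrArg (koszulAug Q) hy
  rw [koszulAug_koszulD, map_sub, sub_eq_zero, (hc x).2] at h
  exact h

/-- The symmetric bilinear form on `P` induced by a form on `V` through linear parts. -/
def inducedForm (BV : LinearMap.BilinForm k V) {n : ℕ} (p : Fin n → SymAlgebra k V) :
    LinearMap.BilinForm k (Submodule.span k (Set.range p)) :=
  BV.compl₁₂ (linearPart (Module.finBasis k V) ∘ₗ (Submodule.span k (Set.range p)).subtype)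
    (linearPart (Module.finBasis k V) ∘ₗ (Submodule.span k (Set.range p)).subtype)

theorem inducedForm_apply (BV : LinearMap.BilinForm k V) {n : ℕ} (p : Fin n → SymAlgebra k V)
    (x y : Submodule.span k (Set.range p)) :
    inducedForm BV p x y = BV (linearPart (Module.finBasis k V) (x : SymAlgebra k V))
      (linearPart (Module.finBasis k V) (y : SymAlgebra k V)) := rfl

theorem inducedForm_isSymm {BV : LinearMap.BilinForm k V} (hBV : BV.IsSymm) {n : ℕ}
    (p : Fin n → SymAlgebra k V) : (inducedForm BV p).IsSymm :=
  ⟨fun _ _ => hBV.eq _ _⟩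

theorem inducedForm_eq_zero (BV : LinearMap.BilinForm k V) {n : ℕ} {p : Fin n → SymAlgebra k V}
    {m : Fin n → ℕ} (hp : ∀ i, p i ∈ symDegree k V (m i)) (hm : ∀ i, 2 ≤ m i) :
    inducedForm BV p = 0 := by
  have h : ∀ x : Submodule.span k (Set.range p),
      linearPart (Module.finBasis k V) (x : SymAlgebra k V) = 0 := fun x => by
    refine (Submodule.span_le (p := LinearMap.ker (linearPart (Module.finBasis k V)))).2 ?_ x.2
    rintro _ ⟨i, rfl⟩
    exact linearPart_eq_zero _ (hm i) (hp i)
  ext x y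
  rw [inducedForm_apply, h, map_zero]
  rfl

/-- After augmentation this is the Clifford relation between two linear parts. The form `Q` enters
through an equation so that the literal zero form of the classical case is covered too. -/
theorem hasScalarClass_anticommutator {W : Subgroup (V ≃ₗ[k] V)} {n : ℕ}
    {p : Fin n → SymAlgebra k V} {m : Fin n → ℕ} (hp : IsInvariantGenerators W p m)
    {BV : LinearMap.BilinForm k V} (hBV : BV.IsSymm) (hQ : Q = BV.toQuadraticMap)
    {x y : Submodule.span k (Set.range p)} {C C' : KoszulAlgebra Q}
    (hC : IsTransgressionCochain Q x C) (hC' : IsTransgressionCochain Q y C') :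
    HasScalarClass Q ((2 : k)⁻¹ • (C * C' + C' * C)) (inducedForm BV p x y) := by
  rw [hasScalarClass_iff, map_smul, koszulD_anticommutator hC hC', smul_zero]
  refine ⟨rfl, ?_⟩
  rw [map_smul, map_add, map_mul, map_mul, hC.koszulAug_eq hp, hC'.koszulAug_eq hp,
    ι_mul_ι_add_swap, inducedForm_apply, hQ, LinearMap.BilinMap.polar_toQuadraticMap,
    ← hBV.eq, ← two_mul, map_mul, ← Algebra.smul_def, inv_smul_smul₀ two_ne_zero]

theorem hasScalarClass_sum_partialD {n : ℕ} (p : Fin n → SymAlgebra k V)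
    (BV : LinearMap.BilinForm k V) {κ : Type*} [Fintype κ] (e : Module.Basis κ k V)
    (x y : Submodule.span k (Set.range p)) :
    HasScalarClass Q ((∑ a, ∑ b, BV (e a) (e b) •
      (partialD e a (x : SymAlgebra k V) * partialD e b (y : SymAlgebra k V))) ⊗ₜ 1)
      (inducedForm BV p x y) := by
  rw [hasScalarClass_iff]
  refine ⟨koszulD_tmul_one Q _, ?_⟩
  rw [koszulAug_tmul, inducedForm_apply, linearPart_eq (Module.finBasis k V) e,
    linearPart_eq (Module.finBasis k V) e,
    linearPart_apply, linearPart_apply, Algebra.algebraMap_eq_smul_one]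
  congr 1
  simp only [map_sum, map_smul, map_mul, LinearMap.sum_apply, LinearMap.smul_apply, smul_eq_mul,
    Finset.mul_sum]
  rw [Finset.sum_comm]
  exact Finset.sum_congr rfl fun a _ => Finset.sum_congr rfl fun b _ => by ring

end Transgression

/-! ### Cohomology of the quotient by the invariants -/

section QuotientCohomology

variable {k V : Type*} [Field k] [AddCommGroup V] [Module k V] [FiniteDimensional k V]
  {Q : QuadraticForm k V} {n : ℕ} {p : Fin n → SymAlgebra k V}

section HasQuotClass

variable {C C' : KoszulAlgebra Q} {c c' : (koszulQuot Q p).Cohomology}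

theorem HasQuotClass.add (h : HasQuotClass Q p C c) (h' : HasQuotClass Q p C' c') :
    HasQuotClass Q p (C + C') (c + c') := by
  obtain ⟨h, rfl⟩ := h
  obtain ⟨h', rfl⟩ := h'
  exact ⟨(koszulQuot Q p).cocycles.add_mem h h', rfl⟩

theorem HasQuotClass.mul (h : HasQuotClass Q p C c) (h' : HasQuotClass Q p C' c') :
    HasQuotClass Q p (C * C') (c * c') := by
  obtain ⟨h, rfl⟩ := h
  obtain ⟨h', rfl⟩ := h'
  exact ⟨(koszulQuot Q p).cocycles.mul_mem h h', rfl⟩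

theorem hasQuotClass_algebraMap (r : k) :
    HasQuotClass Q p (algebraMap k _ r) (algebraMap k _ r) :=
  ⟨(koszulQuot Q p).cocycles.algebraMap_mem r, rfl⟩

theorem HasQuotClass.eq (h : HasQuotClass Q p C c) (h' : HasQuotClass Q p C c') : c = c' := by
  obtain ⟨h, rfl⟩ := h
  obtain ⟨h', rfl⟩ := h'
  rfl

theorem koszulQuot_d_mk (C : KoszulAlgebra Q) :
    (koszulQuot Q p).d (Ideal.Quotient.mk _ C) = Ideal.Quotient.mk _ (koszulD Q C) := rfl

theorem HasQuotClass.of_sub_mem {y : KoszulAlgebra Q}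
    (hy : C - C' - koszulD Q y ∈ DiffSuperAlgebra.idealOf (koszulGen Q p))
    (h' : HasQuotClass Q p C' c') : HasQuotClass Q p C c' := by
  obtain ⟨h', rfl⟩ := h'
  have hC : Ideal.Quotient.mk (DiffSuperAlgebra.idealOf (koszulGen Q p)) C =
      Ideal.Quotient.mk _ C' + (koszulQuot Q p).d (Ideal.Quotient.mk _ y) := by
    rw [koszulQuot_d_mk, ← map_add, Ideal.Quotient.eq, ← sub_sub]
    exact hy
  have hz : (koszulQuot Q p).d (Ideal.Quotient.mk _ C) = 0 := by
    rw [hC, map_add, h', (koszulQuot Q p).d_d, add_zero]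
  refine ⟨hz, ?_⟩
  rw [DiffSuperAlgebra.cls, DiffSuperAlgebra.cls, Ideal.Quotient.eq]
  exact ⟨Ideal.Quotient.mk _ y, (sub_eq_iff_eq_add'.2 hC).symm⟩

theorem HasQuotClass.exists_sub_mem (h : HasQuotClass Q p C 0) :
    ∃ y, C - koszulD Q y ∈ DiffSuperAlgebra.idealOf (koszulGen Q p) := by
  obtain ⟨h, h0⟩ := h
  obtain ⟨y, hy⟩ := Ideal.Quotient.eq_zero_iff_mem.1 h0
  obtain ⟨y, rfl⟩ := Ideal.Quotient.mk_surjective y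
  refine ⟨y, ?_⟩
  rw [← Ideal.Quotient.eq, eq_comm]
  exact hy

theorem exists_hasQuotClass (c : (koszulQuot Q p).Cohomology) :
    ∃ C, koszulD Q C ∈ DiffSuperAlgebra.idealOf (koszulGen Q p) ∧ HasQuotClass Q p C c := by
  obtain ⟨⟨z, hz⟩, rfl⟩ := Ideal.Quotient.mk_surjective c
  obtain ⟨C, rfl⟩ := Ideal.Quotient.mk_surjective z
  exact ⟨C, Ideal.Quotient.eq_zero_iff_mem.1 hz, hz, rfl⟩

theorem tmul_one_mem_idealOf {f : SymAlgebra k V} (hf : f ∈ Submodule.span k (Set.range p)) :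
    f ⊗ₜ[k] (1 : CliffordAlgebra Q) ∈ DiffSuperAlgebra.idealOf (koszulGen Q p) := by
  induction hf using Submodule.span_induction with
  | mem x hx =>
    obtain ⟨i, rfl⟩ := hx
    exact TwoSidedIdeal.mem_asIdeal.2 (TwoSidedIdeal.subset_span ⟨i, rfl⟩)
  | zero => rw [TensorProduct.zero_tmul]; exact zero_mem _
  | add x y _ _ hx hy => rw [TensorProduct.add_tmul]; exact add_mem hx hy
  | smul r x _ hx =>
    rw [← TensorProduct.smul_tmul', Algebra.smul_def]
    exact Ideal.mul_mem_left _ _ hx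

theorem IsTransgressionCochain.koszulQuot_d_eq_zero {x : Submodule.span k (Set.range p)}
    (h : IsTransgressionCochain Q x C) :
    (koszulQuot Q p).d (Ideal.Quotient.mk _ C) = 0 := by
  rw [koszulQuot_d_mk, show koszulD Q C = _ from h.2, Ideal.Quotient.eq_zero_iff_mem]
  exact tmul_one_mem_idealOf x.2

end HasQuotClass

variable {W : Subgroup (V ≃ₗ[k] V)}

theorem invariants_smul_eq (r : invariants W) (z : KoszulAlgebra Q) :
    r • z = (r : SymAlgebra k V) ⊗ₜ 1 * z := by
  induction z using TensorProduct.induction_on with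
  | zero => simp
  | add x y hx hy => rw [smul_add, mul_add, hx, hy]
  | tmul g c => rw [Algebra.TensorProduct.tmul_mul_tmul, one_mul]; rfl

theorem koszulD_invariants_smul (r : invariants W) (z : KoszulAlgebra Q) :
    koszulD Q (r • z) = r • koszulD Q z := by
  rw [invariants_smul_eq, invariants_smul_eq, koszulD_tmul_one_mul]

theorem mul_invariants_smul (r : invariants W) (a z : KoszulAlgebra Q) :
    a * r • z = r • (a * z) := by
  rw [invariants_smul_eq, invariants_smul_eq, ← mul_assoc, ← tmul_one_mul_comm, mul_assoc]

variable {m : Fin n → ℕ} (hp : IsInvariantGenerators W p m)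

namespace IsInvariantGenerators

include hp

theorem mem_invariants (i : Fin n) : p i ∈ invariants W := by
  rw [← hp.adjoin_eq]
  exact Algebra.subset_adjoin ⟨i, rfl⟩

/-- The ideal of the invariants generated by the `p j` with `j < i`. -/
def initialIdeal (hp : IsInvariantGenerators W p m) (i : ℕ) : Ideal (invariants W) :=
  Ideal.span ((fun j => ⟨p j, hp.mem_invariants j⟩) '' {j : Fin n | j.1 < i})

theorem initialIdeal_zero : hp.initialIdeal 0 = ⊥ := by
  simp [initialIdeal]

theorem initialIdeal_succ {i : ℕ} (hi : i < n) :
    hp.initialIdeal (i + 1) =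
      Ideal.span {⟨p ⟨i, hi⟩, hp.mem_invariants _⟩} ⊔ hp.initialIdeal i := by
  have h : {j : Fin n | j.1 < i + 1} = insert ⟨i, hi⟩ {j : Fin n | j.1 < i} := by
    ext j
    simp only [Set.mem_ofPred_eq, Set.mem_insert_iff, Fin.ext_iff]
    omega
  rw [initialIdeal, h, Set.image_insert_eq, Ideal.span_insert]
  rfl

/-- The invariants are a polynomial algebra in the generators. -/
def equivMvPolynomial (hp : IsInvariantGenerators W p m) :
    MvPolynomial (Fin n) k ≃ₐ[k] invariants W :=
  hp.algebraicIndependent.aevalEquiv.trans (Subalgebra.equivOfEq _ _ hp.adjoin_eq)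

theorem equivMvPolynomial_X (i : Fin n) :
    hp.equivMvPolynomial (MvPolynomial.X i) = ⟨p i, hp.mem_invariants i⟩ := by
  apply Subtype.ext
  simp [equivMvPolynomial]

theorem mem_initialIdeal_iff (i : ℕ) (s : MvPolynomial (Fin n) k) :
    hp.equivMvPolynomial s ∈ hp.initialIdeal i ↔
      s ∈ Ideal.span (MvPolynomial.X '' {j : Fin n | j.1 < i} : Set (MvPolynomial (Fin n) k)) := by
  have h : hp.initialIdeal i = (Ideal.span (MvPolynomial.X '' {j : Fin n | j.1 < i} :
      Set (MvPolynomial (Fin n) k))).map hp.equivMvPolynomial := by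
    rw [Ideal.map_span, ← Set.image_comp, initialIdeal]
    congr 2
    exact funext fun j => (hp.equivMvPolynomial_X j).symm
  rw [h]
  constructor
  · intro hs
    obtain ⟨t, ht, hts⟩ := (Ideal.mem_map_of_equiv hp.equivMvPolynomial _).1 hs
    exact hp.equivMvPolynomial.injective hts ▸ ht
  · exact fun hs => Ideal.mem_map_of_mem _ hs

/-- In the polynomial algebra on the `p i` this is regularity of the sequence of variables. -/
theorem mem_initialIdeal_of_mul_mem (i : Fin n) {s : invariants W}
    (hs : ⟨p i, hp.mem_invariants i⟩ * s ∈ hp.initialIdeal i) : s ∈ hp.initialIdeal i := by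
  obtain ⟨s, rfl⟩ := hp.equivMvPolynomial.surjective s
  rw [← hp.equivMvPolynomial_X, ← map_mul, mem_initialIdeal_iff] at hs
  rw [mem_initialIdeal_iff]
  exact MvPolynomial.mem_span_X_image_of_X_mul_mem (by simp) hs

variable (Q) in
/-- The submodule of the Koszul algebra generated by the `p j` with `j < i`. -/
def initialSubmodule (hp : IsInvariantGenerators W p m) (i : ℕ) :
    Submodule (invariants W) (KoszulAlgebra Q) :=
  hp.initialIdeal i • ⊤

theorem mem_initialSubmodule_succ {i : ℕ} (hi : i < n) {x : KoszulAlgebra Q} :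
    x ∈ hp.initialSubmodule Q (i + 1) ↔
      ∃ y, ∃ u ∈ hp.initialSubmodule Q i, x = p ⟨i, hi⟩ ⊗ₜ 1 * y + u := by
  rw [initialSubmodule, hp.initialIdeal_succ hi, Submodule.sup_smul,
    Submodule.ideal_span_singleton_smul, Submodule.mem_sup]
  constructor
  · rintro ⟨_, hy, u, hu, rfl⟩
    obtain ⟨y, -, rfl⟩ := (Submodule.mem_smul_pointwise_iff_exists _ _ _).1 hy
    exact ⟨y, u, hu, by rw [invariants_smul_eq]⟩
  · rintro ⟨y, u, hu, rfl⟩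
    exact ⟨_, (Submodule.mem_smul_pointwise_iff_exists _ _ _).2 ⟨y, trivial, rfl⟩, u, hu,
      by rw [invariants_smul_eq]⟩

theorem koszulD_mem_initialSubmodule {i : ℕ} {x : KoszulAlgebra Q}
    (hx : x ∈ hp.initialSubmodule Q i) : koszulD Q x ∈ hp.initialSubmodule Q i := by
  induction hx using Submodule.smul_induction_on' with
  | smul r hr x _ =>
    rw [koszulD_invariants_smul]
    exact Submodule.smul_mem_smul hr trivial
  | add x _ y _ hx hy => rw [map_add]; exact add_mem hx hy

theorem mul_mem_initialSubmodule {i : ℕ} (a : KoszulAlgebra Q) {x : KoszulAlgebra Q}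
    (hx : x ∈ hp.initialSubmodule Q i) : a * x ∈ hp.initialSubmodule Q i := by
  induction hx using Submodule.smul_induction_on' with
  | smul r hr x _ =>
    rw [mul_invariants_smul]
    exact Submodule.smul_mem_smul hr trivial
  | add x _ y _ hx hy => rw [mul_add]; exact add_mem hx hy

theorem mul_mem_initialSubmodule_right {i : ℕ} (a : KoszulAlgebra Q) {x : KoszulAlgebra Q}
    (hx : x ∈ hp.initialSubmodule Q i) : x * a ∈ hp.initialSubmodule Q i := by
  induction hx using Submodule.smul_induction_on' with
  | smul r hr x _ =>
    rw [invariants_smul_eq, mul_assoc, ← invariants_smul_eq]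
    exact Submodule.smul_mem_smul hr trivial
  | add x _ y _ hx hy => rw [add_mul]; exact add_mem hx hy

/-- The generators are central, so the submodule they generate over the invariants is already a
two-sided ideal. -/
theorem mem_idealOf_iff {x : KoszulAlgebra Q} :
    x ∈ DiffSuperAlgebra.idealOf (koszulGen Q p) ↔ x ∈ hp.initialSubmodule Q n := by
  constructor
  · intro hx
    rw [TwoSidedIdeal.mem_asIdeal] at hx
    induction hx using TwoSidedIdeal.span_induction with
    | mem x h =>
      obtain ⟨i, rfl⟩ := h
      have : p i ⊗ₜ[k] (1 : CliffordAlgebra Q) =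
          (⟨p i, hp.mem_invariants i⟩ : invariants W) • 1 := by
        rw [invariants_smul_eq, mul_one]
      change p i ⊗ₜ[k] (1 : CliffordAlgebra Q) ∈ _
      rw [this]
      exact Submodule.smul_mem_smul (Ideal.subset_span ⟨i, i.2, rfl⟩) trivial
    | zero => exact zero_mem _
    | add x y _ _ hx hy => exact add_mem hx hy
    | neg x _ hx => exact neg_mem hx
    | left_absorb a x _ hx => exact hp.mul_mem_initialSubmodule a hx
    | right_absorb a x _ hx => exact hp.mul_mem_initialSubmodule_right a hx
  · intro hx
    induction hx using Submodule.smul_induction_on' with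
    | smul r hr x _ =>
      induction hr using Submodule.span_induction with
      | mem r h =>
        obtain ⟨i, -, rfl⟩ := h
        rw [invariants_smul_eq, tmul_one_mul_comm]
        exact Ideal.mul_mem_left _ _ (tmul_one_mem_idealOf (Submodule.subset_span ⟨i, rfl⟩))
      | zero => rw [zero_smul]; exact zero_mem _
      | add r s _ _ hr hs => rw [add_smul]; exact add_mem hr hs
      | smul t r _ hr =>
        rw [smul_eq_mul, mul_smul, invariants_smul_eq]
        exact Ideal.mul_mem_left _ _ hr
    | add x _ y _ hx hy => exact add_mem hx hy

/-- Freeness over the invariants enters here, to carry regularity from the polynomial algebra of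
invariants to the Koszul algebra. The value `0` at indices from `n` on is a placeholder. -/
theorem isRegularTransgressive (hW : IsFiniteReflectionGroup W) [CharZero k]
    {C : Fin n → KoszulAlgebra Q} (hC : ∀ i, IsTransgressionCochain Q (p i) (C i)) :
    (koszul Q).IsRegularTransgressive n
      (fun i => if h : i < n then p ⟨i, h⟩ ⊗ₜ 1 else 0)
      (fun i => if h : i < n then C ⟨i, h⟩ else 0)
      (fun i => (hp.initialSubmodule Q i).toAddSubgroup) where
  zero := by
    rw [initialSubmodule, hp.initialIdeal_zero, Submodule.bot_smul]
    rfl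
  mem_succ i hi x := by
    simp only [dif_pos hi]
    exact hp.mem_initialSubmodule_succ hi
  d_mem i _ x hx := hp.koszulD_mem_initialSubmodule hx
  mul_mem i _ a x hx := hp.mul_mem_initialSubmodule a hx
  regular i hi y hy := by
    simp only [dif_pos hi] at hy
    have := free_koszulAlgebra hW Q
    have hy' : (⟨p ⟨i, hi⟩, hp.mem_invariants _⟩ : invariants W) • y ∈
        hp.initialIdeal i • (⊤ : Submodule (invariants W) (KoszulAlgebra Q)) := by
      rw [invariants_smul_eq]
      exact hy
    exact mem_smul_top_of_smul_mem (fun s hs => hp.mem_initialIdeal_of_mul_mem ⟨i, hi⟩ hs) hy'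
  central i hi y := by
    simp only [dif_pos hi]
    exact tmul_one_mul_comm _ y
  parity_C i hi := by
    simp only [dif_pos hi]
    exact (hC _).1
  d_C i hi := by
    simp only [dif_pos hi]
    exact (hC _).2

end IsInvariantGenerators

variable [CharZero k]

/-- The two components of a pair are built by the same ordered expression, so the cochain represents
the image of the Clifford element. -/
theorem hasQuotClass_of_mem_orderedProductSpan
    {q : QuadraticForm k (Submodule.span k (Set.range p))}
    (Φ : CliffordAlgebra q →ₐ[k] (koszulQuot Q p).Cohomology)
    {w : ℕ → Submodule.span k (Set.range p)} {C : ℕ → KoszulAlgebra Q} {i : ℕ}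
    (hΦ : ∀ j < i, HasQuotClass Q p (C j) (Φ (CliffordAlgebra.ι q (w j))))
    {x : CliffordAlgebra q × KoszulAlgebra Q}
    (hx : x ∈ orderedProductSpan (k := k) (fun j => CliffordAlgebra.ι q (w j)) C i) :
    HasQuotClass Q p x.2 (Φ x.1) := by
  induction i generalizing x with
  | zero =>
    obtain ⟨r, rfl⟩ := mem_orderedProductSpan_zero.1 hx
    have := hasQuotClass_algebraMap (Q := Q) (p := p) r
    rwa [Algebra.algebraMap_eq_smul_one, ← AlgHom.commutes Φ,
      Algebra.algebraMap_eq_smul_one] at this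
  | succ i ih =>
    obtain ⟨x, hx', y, hy, rfl⟩ := mem_orderedProductSpan_succ.1 hx
    have h1 := ih (fun j hj => hΦ j (hj.trans (Nat.lt_succ_self i))) hx'
    have h2 := ih (fun j hj => hΦ j (hj.trans (Nat.lt_succ_self i))) hy
    have h3 := h1.add ((hΦ i (Nat.lt_succ_self i)).mul h2)
    rw [← map_mul, ← map_add] at h3
    exact h3

-- The square of a cochain for `x` is a cocycle whose scalar class, read off by the augmentation, is
-- `Q` of the linear part of `x`. This is the Clifford relation, and the universal property applies.
include hp in
theorem exists_algHom_hasQuotClass (q : QuadraticForm k (Submodule.span k (Set.range p)))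
    (hq : ∀ x, q x = Q (linearPart (Module.finBasis k V) (x : SymAlgebra k V))) :
    ∃ Φ : CliffordAlgebra q →ₐ[k] (koszulQuot Q p).Cohomology,
      ∀ (x : Submodule.span k (Set.range p)) (C : KoszulAlgebra Q),
        IsTransgressionCochain Q x C → HasQuotClass Q p C (Φ (CliffordAlgebra.ι q x)) := by
  obtain ⟨c, hc⟩ := exists_linear_transgressionCochain hp Q
  let φ : Submodule.span k (Set.range p) →ₗ[k] (koszulQuot Q p).Cohomology :=
    { toFun := fun x => (koszulQuot Q p).cls (Ideal.Quotient.mk _ (c x))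
        (hc x).1.koszulQuot_d_eq_zero
      map_add' := fun x y => by
        have h : HasQuotClass Q p (c (x + y)) _ := ⟨(hc (x + y)).1.koszulQuot_d_eq_zero, rfl⟩
        refine h.eq ?_
        rw [map_add]
        exact HasQuotClass.add ⟨_, rfl⟩ ⟨_, rfl⟩
      map_smul' := fun r x => by
        have h : HasQuotClass Q p (c (r • x)) _ := ⟨(hc (r • x)).1.koszulQuot_d_eq_zero, rfl⟩
        refine h.eq ?_
        rw [map_smul, RingHom.id_apply, Algebra.smul_def, Algebra.smul_def]
        exact HasQuotClass.mul (hasQuotClass_algebraMap r) ⟨_, rfl⟩ }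
  have hφ : ∀ x, HasQuotClass Q p (c x) (φ x) := fun x => ⟨_, rfl⟩
  have hsq : ∀ x, φ x * φ x = algebraMap k _ (q x) := fun x => by
    have hd : koszulD Q (c x * c x) = 0 := by
      have := koszulD_anticommutator (hc x).1 (hc x).1
      -- The anticommutator of `c x` with itself is twice its square.
      rw [← two_smul k, map_smul] at this
      exact (smul_eq_zero.1 this).resolve_left two_ne_zero
    obtain ⟨r, y, hy⟩ := exists_eq_add_koszulD Q hd
    have hr : r = q x := by
      have h2 : Invertible (2 : k) := invertibleOfNonzero two_ne_zero
      have h := congrArg (koszulAug Q) hy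
      rw [map_mul, (hc x).2, CliffordAlgebra.ι_sq_scalar, map_add, koszulAug_koszulD, add_zero,
        AlgHom.commutes, ← hq] at h
      exact ((algebraMap k (CliffordAlgebra Q)).injective h).symm
    refine ((hφ x).mul (hφ x)).eq (HasQuotClass.of_sub_mem (y := y) ?_
      (hasQuotClass_algebraMap (q x)))
    rw [hy, hr, add_sub_cancel_left, sub_self]
    exact zero_mem _
  refine ⟨CliffordAlgebra.lift q ⟨φ, hsq⟩, fun x C hC => ?_⟩
  rw [CliffordAlgebra.lift_ι_apply]
  obtain ⟨y, hy⟩ := hC.exists_sub_eq (hc x).1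
  refine HasQuotClass.of_sub_mem (y := y) ?_ (hφ x)
  rw [hy, sub_self]
  exact zero_mem _

include hp in
/-- The cohomology of the quotient of the Koszul algebra by the ideal of the invariants is the
Clifford algebra of the space spanned by the generators. -/
theorem exists_algEquiv_hasQuotClass (hW : IsFiniteReflectionGroup W)
    (q : QuadraticForm k (Submodule.span k (Set.range p)))
    (hq : ∀ x, q x = Q (linearPart (Module.finBasis k V) (x : SymAlgebra k V))) :
    ∃ Φ : CliffordAlgebra q ≃ₐ[k] (koszulQuot Q p).Cohomology,
      ∀ (x : Submodule.span k (Set.range p)) (C : KoszulAlgebra Q),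
        IsTransgressionCochain Q x C → HasQuotClass Q p C (Φ (CliffordAlgebra.ι q x)) := by
  have h2 : Invertible (2 : k) := invertibleOfNonzero two_ne_zero
  obtain ⟨Φ, hΦ⟩ := exists_algHom_hasQuotClass hp q hq
  let b : Fin n → Submodule.span k (Set.range p) :=
    fun i => ⟨p i, Submodule.subset_span ⟨i, rfl⟩⟩
  let w : ℕ → Submodule.span k (Set.range p) := fun i => if h : i < n then b ⟨i, h⟩ else 0
  have hwj : ∀ (j : ℕ) (hj : j < n), w j = b ⟨j, hj⟩ := fun j hj => dif_pos hj
  let C : Fin n → KoszulAlgebra Q :=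
    fun i => transgressionCochain (Module.finBasis k V) Q (m i) (p i)
  have hC : ∀ i, IsTransgressionCochain Q (p i) (C i) := fun i =>
    isTransgressionCochain_transgressionCochain _ Q
      (hp.degree_ne_zero (Module.finBasis k V) i) (hp.homogeneous i)
  have hreg := hp.isRegularTransgressive hW hC
  have hw : Submodule.span k (w '' {j | j < n}) = ⊤ := by
    have h1 : w '' {j | j < n} = Set.range b := by
      ext x
      constructor
      · rintro ⟨j, hj, rfl⟩
        exact ⟨⟨j, hj⟩, (hwj j hj).symm⟩
      · rintro ⟨j, rfl⟩
        exact ⟨j.1, j.2, hwj j.1 j.2⟩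
    rw [h1]
    have h3 : Set.range b = ((↑) : Submodule.span k (Set.range p) → SymAlgebra k V) ⁻¹'
        Set.range p := by
      ext x
      constructor
      · rintro ⟨j, rfl⟩
        exact ⟨j, rfl⟩
      · rintro ⟨j, hj⟩
        exact ⟨j, Subtype.ext hj⟩
    rw [h3]
    exact Submodule.span_span_coe_preimage
  have hcls : ∀ j < n, HasQuotClass Q p (if h : j < n then C ⟨j, h⟩ else 0)
      (Φ (CliffordAlgebra.ι q (w j))) := fun j hj => by
    rw [dif_pos hj, hwj j hj]
    exact hΦ (b ⟨j, hj⟩) _ (hC _)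
  -- If `Φ u = 0`, the companion cochain of `u` is a coboundary modulo the ideal, so the pair
  -- vanishes and `u` with it.
  have hinj : Function.Injective Φ := by
    rw [injective_iff_map_eq_zero]
    intro u hu
    obtain ⟨t, ht⟩ := exists_mem_orderedProductSpan
      (C := fun i => if h : i < n then C ⟨i, h⟩ else 0) hw u
    have h3 := hasQuotClass_of_mem_orderedProductSpan Φ hcls ht
    rw [hu] at h3
    obtain ⟨y, hy⟩ := h3.exists_sub_mem
    rw [hp.mem_idealOf_iff] at hy
    have h4 := hreg.eq_zero_of_sub_mem (fun z hz => exists_eq_add_koszulD Q hz)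
      (fun r y hr => by
        have h5 := koszulAug_koszulD Q y
        rw [← show _ = koszulD Q y from hr, AlgHom.commutes] at h5
        exact (algebraMap k (CliffordAlgebra Q)).injective (by rw [h5, map_zero])) le_rfl ht hy
    exact congrArg Prod.fst h4
  -- A cocycle modulo the ideal is cohomologous to an ordered combination, whose Clifford component
  -- is a preimage.
  have hsurj : Function.Surjective Φ := by
    intro c
    obtain ⟨z, hz, hzc⟩ := exists_hasQuotClass c
    rw [hp.mem_idealOf_iff] at hz
    obtain ⟨x, hx, y, hy⟩ := hreg.exists_sub_mem (v := fun j => CliffordAlgebra.ι q (w j))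
      (fun z hz => exists_eq_add_koszulD Q hz) le_rfl hz
    have h3 := hasQuotClass_of_mem_orderedProductSpan Φ hcls hx
    exact ⟨x.1, (HasQuotClass.of_sub_mem (hp.mem_idealOf_iff.2 hy) h3).eq hzc⟩
  exact ⟨AlgEquiv.ofBijective Φ ⟨hinj, hsurj⟩, hΦ⟩

end QuotientCohomology

end

/-! ### The main theorem -/

theorem mainTheorem7 {k V : Type*} [Field k] [CharZero k] [AddCommGroup V] [Module k V]
    [FiniteDimensional k V] (W : Subgroup (V ≃ₗ[k] V)) (hW : IsFiniteReflectionGroup W) :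
    -- algebraically independent homogeneous generators of the invariants exist
    (∃ (p : Fin (Module.finrank k V) → SymAlgebra k V) (m : Fin (Module.finrank k V) → ℕ),
      IsInvariantGenerators W p m) ∧
    -- the deformed Koszul algebra of a symmetric bilinear form
    (∀ BV : LinearMap.BilinForm k V, BV.IsSymm →
      Function.Bijective (algebraMap k (koszul BV.toQuadraticMap).Cohomology) ∧
      Module.Free (invariants W) (KoszulAlgebra BV.toQuadraticMap) ∧
      ∀ (p : Fin (Module.finrank k V) → SymAlgebra k V) (m : Fin (Module.finrank k V) → ℕ),
        IsInvariantGenerators W p m →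
        (∀ (e : Module.Basis (Fin (Module.finrank k V)) k V)
            (i : Fin (Module.finrank k V)),
          IsTransgressionCochain BV.toQuadraticMap (p i)
            (transgressionCochain e BV.toQuadraticMap (m i) (p i))) ∧
        ∃ B : LinearMap.BilinForm k (Submodule.span k (Set.range p)),
          B.IsSymm ∧
          -- `B` is half the class of the anticommutator of cochains of transgression
          (∀ (x y : Submodule.span k (Set.range p)) (C C' : KoszulAlgebra BV.toQuadraticMap),
            IsTransgressionCochain BV.toQuadraticMap x C →
            IsTransgressionCochain BV.toQuadraticMap y C' →
            HasScalarClass BV.toQuadraticMap ((2 : k)⁻¹ • (C * C' + C' * C)) (B x y)) ∧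
          -- the formula for `B`
          (∀ (e : Module.Basis (Fin (Module.finrank k V)) k V)
            (i j : Fin (Module.finrank k V)),
            HasScalarClass BV.toQuadraticMap
              ((∑ a, ∑ b, BV (e a) (e b) • (partialD e a (p i) * partialD e b (p j))) ⊗ₜ 1)
              (B ⟨p i, Submodule.subset_span ⟨i, rfl⟩⟩ ⟨p j, Submodule.subset_span ⟨j, rfl⟩⟩)) ∧
          ((∀ i, 2 ≤ m i) → B = 0) ∧
          -- the cohomology of the quotient
          ∃ Φ : CliffordAlgebra B.toQuadraticMap ≃ₐ[k] (koszulQuot BV.toQuadraticMap p).Cohomology,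
            ∀ (x : Submodule.span k (Set.range p)) (C : KoszulAlgebra BV.toQuadraticMap),
              IsTransgressionCochain BV.toQuadraticMap x C →
              HasQuotClass BV.toQuadraticMap p C (Φ (CliffordAlgebra.ι B.toQuadraticMap x))) ∧
    -- the classical Koszul algebra `SV ⊗ ⋀V`
    (Function.Bijective (algebraMap k (koszul (0 : QuadraticForm k V)).Cohomology) ∧
      Module.Free (invariants W) (SymAlgebra k V ⊗[k] ExteriorAlgebra k V) ∧
      ∀ (p : Fin (Module.finrank k V) → SymAlgebra k V) (m : Fin (Module.finrank k V) → ℕ),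
        IsInvariantGenerators W p m →
        (∀ (e : Module.Basis (Fin (Module.finrank k V)) k V)
            (i : Fin (Module.finrank k V)),
          IsTransgressionCochain (0 : QuadraticForm k V) (p i)
            (transgressionCochain e (0 : QuadraticForm k V) (m i) (p i))) ∧
        (∀ (x y : Submodule.span k (Set.range p)) (C C' : KoszulAlgebra (0 : QuadraticForm k V)),
          IsTransgressionCochain (0 : QuadraticForm k V) x C →
          IsTransgressionCochain (0 : QuadraticForm k V) y C' →
          HasScalarClass (0 : QuadraticForm k V) ((2 : k)⁻¹ • (C * C' + C' * C)) 0) ∧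
        ∃ Φ : ExteriorAlgebra k (Submodule.span k (Set.range p)) ≃ₐ[k]
            (koszulQuot (0 : QuadraticForm k V) p).Cohomology,
          ∀ (x : Submodule.span k (Set.range p)) (C : KoszulAlgebra (0 : QuadraticForm k V)),
            IsTransgressionCochain (0 : QuadraticForm k V) x C →
            HasQuotClass (0 : QuadraticForm k V) p C
              (Φ (ExteriorAlgebra.ι k x))) := by
  refine ⟨exists_isInvariantGenerators hW, fun BV hBV =>
    ⟨algebraMap_cohomology_bijective _, free_koszulAlgebra hW _, fun p m hp => ⟨fun e i =>
      isTransgressionCochain_transgressionCochain e _ (hp.degree_ne_zero e i) (hp.homogeneous i),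
      inducedForm BV p, inducedForm_isSymm hBV p, fun x y C C' hC hC' =>
        hasScalarClass_anticommutator hp hBV rfl hC hC', fun e i j =>
        hasScalarClass_sum_partialD p BV e ⟨p i, _⟩ ⟨p j, _⟩,
      fun hm => inducedForm_eq_zero BV hp.homogeneous hm,
      exists_algEquiv_hasQuotClass hp hW _ fun x => rfl⟩⟩,
    -- An exterior algebra is the Clifford algebra of the zero form, so the classical case takes the
    -- zero forms on `V` and on `P`.
    algebraMap_cohomology_bijective _, free_koszulAlgebra hW _, fun p m hp => ⟨fun e i =>
      isTransgressionCochain_transgressionCochain e _ (hp.degree_ne_zero e i) (hp.homogeneous i),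
      fun x y C C' hC hC' => ?_, exists_algEquiv_hasQuotClass hp hW 0 fun x => rfl⟩⟩
  exact hasScalarClass_anticommutator hp (BV := 0) ⟨fun _ _ => rfl⟩
    (LinearMap.BilinMap.toQuadraticMap_zero k V).symm hC hC'
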